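/- Let $d\ge 1$. Let $f:\mathbb R^d\setminus\{0\}\to[0,\infty)$ be continuous and integrable in a neighbourhood of $0$, and suppose that $f$ is the Fourier transform, in the space $\mathcal S'(\mathbb R^d)$ of tempered distributions, of a non-negative tempered measure $\mu$. That is, $f\varphi$ is integrable and $\int f\varphi\,dx=\int \mathcal F\varphi\,d\mu$ for all $\varphi\in\mathcal S(\mathbb R^d)$, where $\mathcal F\varphi(\xi)=\int\varphi(x)e^{-2\pi i\xi\cdot x}dx$, and $\int(1+|\xi|^2)^{-m}\mu(d\xi)<\infty$ for some integer $m\ge1$. (In particular $f$ is non-negative definite.) Let $U$ be the Hilbert space obtained by completing the space $\mathcal S(\mathbb R^d)$ of real Schwartz functions for the semi-inner product $$\langle\varphi,\psi\rangle_U=\int_{\mathbb R^d}dx\int_{\mathbb R^d}dy\,\varphi(x)f(x-y)\psi(y),$$ and let $U_T=L^2([0,T];U)$ for $T>0$. On a probability space $(\Omega,\mathcal F,P)$ let $\{W(\varphi):\varphi\in C_0^\infty(\mathbb R^{d+1})\}$ be a family of mean zero Gaussian random variables with covariance $$E(W(\varphi)W(\psi))=\int_0^\infty dt\int_{\mathbb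 R^d}dx\int_{\mathbb R^d}dy\,\varphi(t,x)f(x-y)\psi(t,y).$$ Then, for each $T>0$, there is a unique linear isometry $W:U_T\to L^2(\Omega,P)$ that extends $\varphi\mapsto W(\varphi)$, $\varphi\in C_0^\infty(\mathbb R^{d+1})$ with support in $[0,T]\times\mathbb R^d$. For $t\ge0$ and $\varphi\in U$ set $W_t(\varphi)=W(1_{[0,t]}(\cdot)\varphi)$, computed in $U_T$ for any $T>0$ with $T\ge t$; up to almost sure equality this does not depend on $T$. After a suitable choice of a version of each of these random variables, $\{W_t(\varphi):t\ge0,\ \varphi\in U\}$ is a standard cylindrical Wiener process on $U$, that is, a cylindrical Wiener process with covariance $Q=\mathrm{Id}_U$: for each $\varphi\in U$, $\{W_t(\varphi),t\ge0\}$ is a Brownian motion with variance $t\|\varphi\|_U^2$ (it starts at $0$, has independent increments, $W_t(\varphi)-W_s(\varphi)\sim N(0,(t-s)\|\varphi\|_U^2)$ for $s\le t$, and has almost surely continuous paths), and for all $s,t\ge0$ and $\varphi,\psi\in U$, $$E(W_t(\varphi)W_s(\psi))=(s\wedge t)\langle\varphi,\psi\rangle_U.$$ -/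

import Mathlib

open MeasureTheory ProbabilityTheory Filter Topology
open scoped NNReal ENNReal SchwartzMap FourierTransform

noncomputable section

/-- The Euclidean space `ℝᵈ`. -/
abbrev Space (d : ℕ) : Type := EuclideanSpace ℝ (Fin d)

/-- A spatial correlation function `f` on `ℝᵈ` with its spectral measure `μ`: `f` is non-negative and
continuous on `ℝᵈ ∖ {0}` (the value `f 0` is irrelevant), integrable near `0`, and it is the Fourier
transform, in the space of tempered distributions, of the non-negative tempered measure `μ`.
The field `integrable_mul` says that the pairing of `f` with Schwartz functions is well defined.
Non-negative definiteness of `f` is a consequence of the field `fourier`. -/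
structure SpatialCorrelation (d : ℕ) where
  f : Space d → ℝ
  μ : Measure (Space d)
  nonneg : ∀ x, x ≠ 0 → 0 ≤ f x
  continuousOn : ContinuousOn f {0}ᶜ
  integrable_near_zero : IntegrableAtFilter f (𝓝 0)
  tempered : ∃ m : ℕ, 1 ≤ m ∧ Integrable (fun ξ => ((1 + ‖ξ‖ ^ 2) ^ m)⁻¹) μ
  integrable_mul : ∀ φ : 𝓢(Space d, ℂ), Integrable (fun x => (f x : ℂ) * φ x)
  fourier : ∀ φ : 𝓢(Space d, ℂ), ∫ x, (f x : ℂ) * φ x = ∫ ξ, 𝓕 φ ξ ∂μ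

namespace SpatialCorrelation

variable {d : ℕ} (C : SpatialCorrelation d)

theorem hasTemperateGrowth : C.μ.HasTemperateGrowth := by
  obtain ⟨m, -, hm⟩ := C.tempered
  refine ⟨2 * m, ?_⟩
  refine (hm.const_mul 1).mono' ?_ ?_
  · exact (Measurable.aestronglyMeasurable (by fun_prop))
  · filter_upwards with x
    rw [Real.norm_of_nonneg (by positivity), Real.rpow_neg (by positivity), one_mul,
      Real.rpow_natCast, pow_mul]
    gcongr
    nlinarith [norm_nonneg x]

theorem fourier_dilate (χ : Space d → ℂ) {R : ℝ} (hR : 0 < R) (ξ : Space d) :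
    𝓕 (fun x => χ (R⁻¹ • x)) ξ = (R ^ d : ℝ) • 𝓕 χ (R • ξ) := by
  rw [Real.fourier_eq, Real.fourier_eq]
  have := Measure.integral_comp_inv_smul (μ := (volume : Measure (Space d)))
    (fun v => Real.fourierChar (-(inner ℝ v (R • ξ))) • χ v) R
  rw [finrank_euclideanSpace_fin, abs_of_pos (pow_pos hR _)] at this
  rw [← this]
  refine integral_congr_ae (.of_forall fun v => ?_)
  simp only [inner_smul_left, inner_smul_right]
  congr 3
  simp
  field_simp

open scoped ContDiff in
theorem exists_ball_bound : ∃ K : ℝ, 0 ≤ K ∧ ∃ χ : Space d → ℝ, (∀ x, 0 ≤ χ x) ∧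
    (∀ x, ‖x‖ ≤ 1 → χ x = 1) ∧ Measurable χ ∧ ∀ n : ℕ, 1 ≤ n →
      Integrable (fun x => C.f x * χ ((n : ℝ)⁻¹ • x)) ∧
      ∫ x, C.f x * χ ((n : ℝ)⁻¹ • x) ≤ K * n ^ d := by
  have := C.hasTemperateGrowth
  let b : ContDiffBump (0 : Space d) := ⟨1, 2, by norm_num, by norm_num⟩
  have hc : HasCompactSupport (fun x => ((b x : ℝ) : ℂ)) :=
    b.hasCompactSupport.comp_left (g := fun r : ℝ => (r : ℂ)) (by simp)
  have hs : ContDiff ℝ ∞ (fun x => ((b x : ℝ) : ℂ)) :=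
    Complex.ofRealCLM.contDiff.comp b.contDiff
  let χ : 𝓢(Space d, ℂ) := hc.toSchwartzMap hs
  obtain ⟨k, hk⟩ := this.exists_integrable
  let A : ℝ := 2 ^ k * (Finset.Iic (k, 0)).sup (fun m => SchwartzMap.seminorm ℝ m.1 m.2) (𝓕 χ)
  have hA : ∀ ξ, ‖𝓕 χ ξ‖ ≤ A * (1 + ‖ξ‖) ^ (-(k : ℝ)) := fun ξ => by
    have := SchwartzMap.one_add_le_sup_seminorm_apply (𝕜 := ℝ) (m := (k, 0)) (k := k) (n := 0)
      le_rfl le_rfl (𝓕 χ) ξ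
    rw [norm_iteratedFDeriv_zero] at this
    rw [Real.rpow_neg (by positivity), Real.rpow_natCast, ← div_eq_mul_inv, le_div_iff₀ (by positivity)]
    linarith
  have hA0 : 0 ≤ A := by positivity
  refine ⟨A * ∫ ξ, (1 + ‖ξ‖) ^ (-(k : ℝ)) ∂C.μ, by positivity, b, fun x => b.nonneg,
    fun x hx => b.one_of_mem_closedBall (by simpa using hx), b.continuous.measurable, ?_⟩
  intro n hn
  have hn0 : (0 : ℝ) < n := by positivity
  have hne : (n : ℝ)⁻¹ ≠ 0 := by positivity
  have hcn : HasCompactSupport (fun x : Space d => ((b ((n : ℝ)⁻¹ • x) : ℝ) : ℂ)) :=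
    hc.comp_smul hne
  have hsn : ContDiff ℝ ∞ (fun x : Space d => ((b ((n : ℝ)⁻¹ • x) : ℝ) : ℂ)) :=
    hs.comp (contDiff_const_smul _)
  let χn : 𝓢(Space d, ℂ) := hcn.toSchwartzMap hsn
  have h1 := C.integrable_mul χn
  have h2 := C.fourier χn
  have e : (fun x => (C.f x : ℂ) * χn x) = fun x => ((C.f x * b ((n : ℝ)⁻¹ • x) : ℝ) : ℂ) := by
    ext x
    push_cast
    rfl
  rw [e] at h1 h2
  refine ⟨by simpa using h1.re, ?_⟩
  rw [integral_complex_ofReal] at h2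
  have h3 : ∫ x, C.f x * b ((n : ℝ)⁻¹ • x) ≤ ‖∫ ξ, 𝓕 χn ξ ∂C.μ‖ := by
    rw [← h2]
    exact (le_abs_self _).trans_eq (by simp)
  refine h3.trans ?_
  have h4 : ∀ ξ, ‖𝓕 χn ξ‖ ≤ (A * n ^ d) * (1 + ‖ξ‖) ^ (-(k : ℝ)) := fun ξ => by
    have : 𝓕 χn ξ = ((n : ℝ) ^ d) • 𝓕 χ ((n : ℝ) • ξ) :=
      fourier_dilate (fun x => ((b x : ℝ) : ℂ)) hn0 ξ
    rw [this, norm_smul, Real.norm_of_nonneg (by positivity)]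
    have h5 : (1 + ‖(n : ℝ) • ξ‖) ^ (-(k : ℝ)) ≤ (1 + ‖ξ‖) ^ (-(k : ℝ)) := by
      apply Real.rpow_le_rpow_of_nonpos (by positivity) _ (by simp)
      rw [norm_smul, Real.norm_of_nonneg (by positivity)]
      have : (1 : ℝ) ≤ n := by exact_mod_cast hn
      nlinarith [norm_nonneg ξ]
    calc _ ≤ (n : ℝ) ^ d * (A * (1 + ‖ξ‖) ^ (-(k : ℝ))) := by
            gcongr
            exact (hA _).trans (by gcongr)
      _ = _ := by ring
  calc _ ≤ ∫ ξ, (A * n ^ d) * (1 + ‖ξ‖) ^ (-(k : ℝ)) ∂C.μ :=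
        norm_integral_le_of_norm_le (hk.const_mul _) (.of_forall h4)
    _ = _ := by rw [integral_const_mul]; ring


theorem exists_decay (φ : 𝓢(Space d, ℝ)) (k : ℕ) :
    ∃ A : ℝ, 0 ≤ A ∧ ∀ x, ‖φ x‖ ≤ A * ((1 + ‖x‖) ^ k)⁻¹ := by
  refine ⟨2 ^ k * (Finset.Iic (k, 0)).sup (fun m => SchwartzMap.seminorm ℝ m.1 m.2) φ,
    by positivity, fun x => ?_⟩
  have := SchwartzMap.one_add_le_sup_seminorm_apply (𝕜 := ℝ) (m := (k, 0)) (k := k) (n := 0)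
      le_rfl le_rfl φ x
  rw [norm_iteratedFDeriv_zero] at this
  rw [← div_eq_mul_inv, le_div_iff₀ (by positivity)]
  linarith

/-- A real Schwartz function, viewed as a complex-valued one. -/
def complexify (φ : 𝓢(Space d, ℝ)) : 𝓢(Space d, ℂ) := φ.postcompCLM Complex.ofRealCLM

/-- The reflected function `x ↦ φ(-x)`. -/
def reflect (φ : 𝓢(Space d, ℂ)) : 𝓢(Space d, ℂ) :=
  SchwartzMap.compCLMOfContinuousLinearEquiv ℂ (ContinuousLinearEquiv.neg ℝ) φ

theorem fourier_reflect (φ : 𝓢(Space d, ℝ)) (ξ : Space d) :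
    𝓕 (reflect (complexify φ)) ξ = starRingEnd ℂ (𝓕 (complexify φ) ξ) := by
  rw [SchwartzMap.fourier_coe, SchwartzMap.fourier_coe, Real.fourier_eq', Real.fourier_eq',
    ← integral_conj, ← integral_neg_eq_self]
  refine integral_congr_ae (.of_forall fun x => ?_)
  simp only [reflect, complexify, SchwartzMap.compCLMOfContinuousLinearEquiv_apply]
  simp [← Complex.exp_conj, Complex.conj_ofNat]

/-- The bilinear form `⟨φ, ψ⟩ = ∫ dx ∫ dy φ(x) f(x - y) ψ(y)` on real Schwartz functions. -/
def form (φ ψ : 𝓢(Space d, ℝ)) : ℝ := ∫ x, ∫ y, φ x * C.f (x - y) * ψ y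

theorem complexify_add (φ ψ : 𝓢(Space d, ℝ)) :
    complexify (φ + ψ) = complexify φ + complexify ψ := by simp [complexify]

theorem complexify_smul (r : ℝ) (φ : 𝓢(Space d, ℝ)) :
    complexify (r • φ) = (r : ℂ) • complexify φ := by
  ext x; simp [complexify]

theorem integrable_fourier_mul (φ ψ : 𝓢(Space d, ℝ)) :
    Integrable (fun ξ => 𝓕 (complexify φ) ξ * starRingEnd ℂ (𝓕 (complexify ψ) ξ)) C.μ := by
  have := C.hasTemperateGrowth
  have h := (SchwartzMap.pairing (ContinuousLinearMap.mul ℂ ℂ) (𝓕 (complexify φ))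
    (𝓕 (reflect (complexify ψ)))).integrable (μ := C.μ)
  refine h.congr (.of_forall fun ξ => ?_)
  rw [SchwartzMap.pairing_apply_apply, fourier_reflect]
  rfl

variable [NeZero d]

theorem ae_nonneg : ∀ᵐ x, 0 ≤ C.f x := by
  have : ∀ᵐ x : Space d, x ≠ 0 := by
    simp [ae_iff]
  filter_upwards [this] with x hx using C.nonneg x hx

theorem aesm : AEStronglyMeasurable C.f volume := by
  have h : AEStronglyMeasurable C.f (volume.restrict {(0 : Space d)}ᶜ) :=
    C.continuousOn.aestronglyMeasurable (measurableSet_singleton 0).compl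
  rwa [Measure.restrict_eq_self_of_ae_mem] at h
  simp [ae_iff]

theorem exists_integrable_weight :
    ∃ N : ℕ, Integrable (fun x => C.f x * ((1 + ‖x‖) ^ N)⁻¹) := by
  obtain ⟨K, hK0, χ, hχ0, hχ1, hχm, hχ⟩ := C.exists_ball_bound
  refine ⟨d + 2, C.aesm.mul (Measurable.aestronglyMeasurable (by fun_prop)), ?_⟩
  let g : ℕ → Space d → ℝ := fun n x =>
    C.f x * χ (((n + 1 : ℕ) : ℝ)⁻¹ • x) * (((n + 1 : ℕ) : ℝ) ^ (d + 2))⁻¹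
  have hgi : ∀ n, Integrable (g n) := fun n => ((hχ (n + 1) (by omega)).1.mul_const _)
  have hg0 : ∀ n, ∀ᵐ x, 0 ≤ g n x := fun n => by
    filter_upwards [C.ae_nonneg] with x hx
    have := hχ0 (((n + 1 : ℕ) : ℝ)⁻¹ • x)
    positivity
  have hgb : ∀ n, ∫⁻ x, ENNReal.ofReal (g n x) ≤
      ENNReal.ofReal (K * (1 / ((n + 1 : ℕ) : ℝ) ^ 2)) := fun n => by
    rw [← ofReal_integral_eq_lintegral_ofReal (hgi n) (hg0 n)]
    apply ENNReal.ofReal_le_ofReal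
    rw [integral_mul_const]
    have h0 : (0 : ℝ) < ((n + 1 : ℕ) : ℝ) := by positivity
    calc _ ≤ (K * ((n + 1 : ℕ) : ℝ) ^ d) * (((n + 1 : ℕ) : ℝ) ^ (d + 2))⁻¹ := by
          gcongr
          exact (hχ (n + 1) (by omega)).2
      _ = _ := by rw [pow_add]; field_simp
  have hsum : Summable (fun n : ℕ => K * (1 / ((n + 1 : ℕ) : ℝ) ^ 2)) :=
    ((summable_nat_add_iff 1).2 (Real.summable_one_div_nat_pow.2 one_lt_two)).mul_left K
  rw [hasFiniteIntegral_iff_norm]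
  calc ∫⁻ x, ENNReal.ofReal ‖C.f x * ((1 + ‖x‖) ^ (d + 2))⁻¹‖
      ≤ ∫⁻ x, ∑' n, ENNReal.ofReal (g n x) := by
        apply lintegral_mono_ae
        filter_upwards [C.ae_nonneg] with x hx
        rw [Real.norm_of_nonneg (by positivity)]
        refine le_trans ?_ (ENNReal.le_tsum ⌊‖x‖⌋₊)
        apply ENNReal.ofReal_le_ofReal
        have h1 : ‖x‖ ≤ ((⌊‖x‖⌋₊ + 1 : ℕ) : ℝ) := by
          push_cast; exact (Nat.lt_floor_add_one _).le
        have h2 : ((⌊‖x‖⌋₊ + 1 : ℕ) : ℝ) ≤ 1 + ‖x‖ := by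
          push_cast; linarith [Nat.floor_le (norm_nonneg x)]
        have h3 : (0 : ℝ) < ((⌊‖x‖⌋₊ + 1 : ℕ) : ℝ) := by positivity
        have h4 : χ (((⌊‖x‖⌋₊ + 1 : ℕ) : ℝ)⁻¹ • x) = 1 := hχ1 _ (by
          rw [norm_smul, norm_inv, Real.norm_of_nonneg h3.le, inv_mul_le_iff₀ h3]
          simpa using h1)
        simp only [g, h4, mul_one]
        gcongr
    _ = ∑' n, ∫⁻ x, ENNReal.ofReal (g n x) :=
        lintegral_tsum fun n => (hgi n).aestronglyMeasurable.aemeasurable.ennreal_ofReal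
    _ ≤ ∑' n, ENNReal.ofReal (K * (1 / ((n + 1 : ℕ) : ℝ) ^ 2)) := ENNReal.tsum_le_tsum hgb
    _ < ⊤ := by
        rw [← ENNReal.ofReal_tsum_of_nonneg (fun n => by positivity) hsum]
        exact ENNReal.ofReal_lt_top

theorem integrable_prod (φ ψ : 𝓢(Space d, ℝ)) :
    Integrable (fun p : Space d × Space d => C.f p.1 * (φ p.2 * ψ (p.2 - p.1)))
      (volume.prod volume) := by
  obtain ⟨N, hN⟩ := C.exists_integrable_weight
  obtain ⟨A, hA0, hA⟩ := exists_decay φ (N + (d + 1))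
  obtain ⟨B, hB0, hB⟩ := exists_decay ψ N
  have hd : Integrable (fun x : Space d => ((1 + ‖x‖) ^ (d + 1))⁻¹) := by
    have := integrable_one_add_norm (E := Space d) (μ := volume) (r := (d + 1 : ℕ)) (by simp)
    refine this.congr (.of_forall fun x => ?_)
    simp only []
    rw [Real.rpow_neg (by positivity), Real.rpow_natCast]
  refine ((hN.mul_prod hd).const_mul (A * B)).mono' ?_ ?_
  · refine C.aesm.comp_fst.mul ?_
    exact Continuous.aestronglyMeasurable (by fun_prop)
  · have h0 : ∀ᵐ p : Space d × Space d ∂(volume.prod volume), 0 ≤ C.f p.1 :=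
      Measure.quasiMeasurePreserving_fst.ae C.ae_nonneg
    filter_upwards [h0] with p hp
    obtain ⟨z, x⟩ := p
    simp only at hp ⊢
    rw [norm_mul, norm_mul, Real.norm_of_nonneg hp]
    have h1 : (1 + ‖z‖) ≤ (1 + ‖x‖) * (1 + ‖x - z‖) := by
      have : ‖z‖ ≤ ‖x‖ + ‖x - z‖ := by
        calc ‖z‖ = ‖x - (x - z)‖ := by simp
          _ ≤ _ := norm_sub_le _ _
      nlinarith [mul_nonneg (norm_nonneg x) (norm_nonneg (x - z))]
    have h2 : ((1 + ‖x‖) ^ N)⁻¹ * ((1 + ‖x - z‖) ^ N)⁻¹ ≤ ((1 + ‖z‖) ^ N)⁻¹ := by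
      rw [← mul_inv, ← mul_pow]
      gcongr
    calc C.f z * (‖φ x‖ * ‖ψ (x - z)‖)
        ≤ C.f z * ((A * ((1 + ‖x‖) ^ (N + (d + 1)))⁻¹) * (B * ((1 + ‖x - z‖) ^ N)⁻¹)) := by
          gcongr
          · exact hA x
          · exact hB _
      _ = (A * B) * (C.f z * (((1 + ‖x‖) ^ N)⁻¹ * ((1 + ‖x - z‖) ^ N)⁻¹) * ((1 + ‖x‖) ^ (d + 1))⁻¹) := by
          rw [pow_add, mul_inv]; ring
      _ ≤ (A * B) * (C.f z * ((1 + ‖z‖) ^ N)⁻¹ * ((1 + ‖x‖) ^ (d + 1))⁻¹) := by gcongr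

theorem form_eq_fourier (φ ψ : 𝓢(Space d, ℝ)) :
    (C.form φ ψ : ℂ) =
      ∫ ξ, 𝓕 (complexify φ) ξ * starRingEnd ℂ (𝓕 (complexify ψ) ξ) ∂C.μ := by
  have h1 : C.form φ ψ = ∫ z, ∫ x, C.f z * (φ x * ψ (x - z)) := by
    rw [integral_integral_swap (C.integrable_prod φ ψ)]
    unfold form
    congr with x
    rw [← integral_sub_left_eq_self _ volume x]
    congr with z
    simp; ring
  let θ := SchwartzMap.convolution (ContinuousLinearMap.mul ℂ ℂ) (complexify φ)
    (reflect (complexify ψ))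
  have h2 := C.fourier θ
  have h3 : ∀ z, θ z = ((∫ x, φ x * ψ (x - z) : ℝ) : ℂ) := fun z => by
    rw [← integral_complex_ofReal]
    simp only [θ, SchwartzMap.convolution_apply, convolution]
    simp [complexify, reflect]
  have h4 : (∫ x, (C.f x : ℂ) * θ x) = (C.form φ ψ : ℂ) := by
    rw [h1, ← integral_complex_ofReal]
    congr with z
    rw [h3, integral_const_mul]
    push_cast; rfl
  rw [← h4, h2]
  congr with ξ
  rw [SchwartzMap.fourier_convolution, SchwartzMap.pairing_apply_apply, fourier_reflect]
  rfl


theorem form_symm (φ ψ : 𝓢(Space d, ℝ)) : C.form ψ φ = C.form φ ψ := by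
  have h : ((C.form ψ φ : ℝ) : ℂ) = starRingEnd ℂ ((C.form φ ψ : ℝ) : ℂ) := by
    rw [form_eq_fourier, form_eq_fourier, ← integral_conj]
    congr with ξ
    simp [mul_comm]
  rw [Complex.conj_ofReal] at h
  exact_mod_cast h

theorem form_self_nonneg (φ : 𝓢(Space d, ℝ)) : 0 ≤ C.form φ φ := by
  have h : ((C.form φ φ : ℝ) : ℂ) =
      ((∫ ξ, Complex.normSq (𝓕 (complexify φ) ξ) ∂C.μ : ℝ) : ℂ) := by
    rw [form_eq_fourier, ← integral_complex_ofReal]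
    congr with ξ
    rw [Complex.mul_conj]
  rw [Complex.ofReal_inj.1 h]
  exact integral_nonneg fun _ => Complex.normSq_nonneg _

theorem form_add_left (φ₁ φ₂ ψ : 𝓢(Space d, ℝ)) :
    C.form (φ₁ + φ₂) ψ = C.form φ₁ ψ + C.form φ₂ ψ := by
  apply Complex.ofReal_injective
  rw [Complex.ofReal_add, form_eq_fourier, form_eq_fourier, form_eq_fourier,
    ← integral_add (C.integrable_fourier_mul _ _) (C.integrable_fourier_mul _ _)]
  congr with ξ
  rw [complexify_add, FourierTransform.fourier_add, add_apply, add_mul]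

theorem form_smul_left (r : ℝ) (φ ψ : 𝓢(Space d, ℝ)) :
    C.form (r • φ) ψ = r * C.form φ ψ := by
  apply Complex.ofReal_injective
  rw [Complex.ofReal_mul, form_eq_fourier, form_eq_fourier, ← integral_const_mul]
  congr with ξ
  rw [complexify_smul, FourierTransform.fourier_smul, smul_apply, smul_eq_mul,
    mul_assoc]

/-- The real vector space of real Schwartz functions on `ℝᵈ`, as a carrier for the semi-inner
product `C.form`. -/
def PreU (_C : SpatialCorrelation d) : Type := 𝓢(Space d, ℝ)

instance : AddCommGroup C.PreU := inferInstanceAs (AddCommGroup 𝓢(Space d, ℝ))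

instance : Module ℝ C.PreU := inferInstanceAs (Module ℝ 𝓢(Space d, ℝ))

/-- The semi-inner product `⟨φ, ψ⟩ = ∫ dx ∫ dy φ(x) f(x - y) ψ(y)` on Schwartz functions. -/
@[reducible]
def preInnerCore : PreInnerProductSpace.Core ℝ C.PreU where
  inner φ ψ := C.form φ ψ
  conj_inner_symm φ ψ := C.form_symm φ ψ
  re_inner_nonneg φ := C.form_self_nonneg φ
  add_left φ₁ φ₂ ψ := C.form_add_left φ₁ φ₂ ψ
  smul_left φ ψ r := C.form_smul_left r φ ψ

instance : SeminormedAddCommGroup C.PreU :=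
  @InnerProductSpace.Core.toSeminormedAddCommGroup ℝ C.PreU _ _ _ C.preInnerCore

instance : InnerProductSpace ℝ C.PreU := InnerProductSpace.ofCore C.preInnerCore

/-- The Hilbert space `U`: the (Hausdorff) completion of the Schwartz space for the seminorm
associated with `C.form`. -/
abbrev U : Type := UniformSpace.Completion C.PreU

/-- The element of `U` represented by a Schwartz function. -/
def toU (φ : 𝓢(Space d, ℝ)) : C.U := UniformSpace.Completion.coe' (α := C.PreU) φ

theorem inner_toU (φ ψ : 𝓢(Space d, ℝ)) :
    inner ℝ (C.toU φ) (C.toU ψ) = ∫ x, ∫ y, φ x * C.f (x - y) * ψ y :=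
  UniformSpace.Completion.inner_coe (𝕜 := ℝ) (E := C.PreU) φ ψ

/-- The space `U_T = L²([0,T]; U)`. -/
abbrev UT (T : ℝ) : Type := Lp C.U 2 (volume.restrict (Set.Icc (0 : ℝ) T))

/-- The element `1_{[0,t]}(·) h` of `U_T`, where `h ∈ U`. -/
def indicatorUT (T t : ℝ) (h : C.U) : C.UT T :=
  indicatorConstLp 2 (measurableSet_Icc : MeasurableSet (Set.Icc (0 : ℝ) t))
    (measure_ne_top _ _) h

end SpatialCorrelation

/-- Smooth compactly supported real functions `φ(t, x)` on `ℝ × ℝᵈ`. -/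
abbrev SpaceTimeTest (d : ℕ) : Type :=
  TestFunction (⊤ : TopologicalSpace.Opens (ℝ × Space d)) ℝ ⊤

/-- The function `x ↦ φ(t, x)`, for a fixed time `t`. -/
def SpaceTimeTest.slice {d : ℕ} (φ : SpaceTimeTest d) (t : ℝ) : 𝓢(Space d, ℝ) :=
  HasCompactSupport.toSchwartzMap (f := fun x => φ (t, x))
    (φ.hasCompactSupport.comp_isClosedEmbedding (Topology.IsClosedEmbedding.of_continuous_injective_isClosedMap
      (by fun_prop) (Prod.mk_right_injective t) (isClosedMap_prodMk_left t)))
    (φ.contDiff.comp (contDiff_prodMk_right t))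

section Noise

variable {Ω : Type*} [MeasurableSpace Ω]

/-- A spatially homogeneous Gaussian noise that is white in time, with spatial correlation `f`:
a family of mean zero Gaussian random variables with covariance
`E(W(φ) W(ψ)) = ∫_0^∞ dt ∫ dx ∫ dy φ(t,x) f(x - y) ψ(t,y)`. -/
structure IsSpatiallyHomogeneousNoise {d : ℕ} (C : SpatialCorrelation d)
    (W : SpaceTimeTest d → Ω → ℝ) (P : Measure Ω) : Prop where
  gaussian : ∀ φ, HasGaussianLaw (W φ) P
  mean_zero : ∀ φ, ∫ ω, W φ ω ∂P = 0
  covariance : ∀ φ ψ, ∫ ω, W φ ω * W ψ ω ∂P =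
    ∫ t in Set.Ici (0 : ℝ), ∫ x, ∫ y, φ (t, x) * C.f (x - y) * ψ (t, y)

/-- `I` is an isometric extension of the noise to `U_T`: a linear isometry from `U_T` into
`L²(Ω, P)` such that every test function `φ` with support in `[0,T] × ℝᵈ`, viewed as the element
`t ↦ φ(t, ·)` of `U_T`, is mapped to `W(φ)`. -/
def IsIsometricExtension {d : ℕ} [NeZero d] (C : SpatialCorrelation d)
    (W : SpaceTimeTest d → Ω → ℝ) (P : Measure Ω) (T : ℝ)
    (I : C.UT T →ₗᵢ[ℝ] Lp ℝ 2 P) : Prop :=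
  ∀ φ : SpaceTimeTest d, tsupport φ ⊆ Set.Icc 0 T ×ˢ Set.univ →
    ∃ g : C.UT T, (g =ᵐ[volume.restrict (Set.Icc (0 : ℝ) T)] fun t => C.toU (φ.slice t)) ∧
      I g =ᵐ[P] W φ

/-- A Brownian motion with variance `v t` at time `t`: it starts at `0`, has independent
increments, the increment over `[s, t]` has law `N(0, v (t - s))`, and its paths are almost surely
continuous. -/
structure IsBrownianMotion (X : ℝ≥0 → Ω → ℝ) (v : ℝ) (P : Measure Ω) : Prop where
  variance_nonneg : 0 ≤ v
  measurable : ∀ t, Measurable (X t)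
  start_zero : ∀ᵐ ω ∂P, X 0 ω = 0
  indep_increments : HasIndepIncrements X P
  law_increments : ∀ s t, s ≤ t →
    HasLaw (fun ω => X t ω - X s ω) (gaussianReal 0 (v.toNNReal * (t - s))) P
  continuous_paths : ∀ᵐ ω ∂P, Continuous fun t => X t ω

/-- A cylindrical Wiener process on the Hilbert space `V` with covariance operator `Q`. -/
structure IsCylindricalWiener {V : Type*} [NormedAddCommGroup V] [InnerProductSpace ℝ V]
    [CompleteSpace V] (Q : V →L[ℝ] V) (B : ℝ≥0 → V → Ω → ℝ) (P : Measure Ω) : Prop where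
  covariance_isPositive : Q.IsPositive
  brownian : ∀ h, IsBrownianMotion (fun t => B t h) (inner ℝ (Q h) h) P
  covariance : ∀ (s t : ℝ≥0) (h g : V),
    ∫ ω, B s h ω * B t g ω ∂P = (min s t : ℝ≥0) * inner ℝ (Q h) g

end Noise

end

/-!
The noise is an isometry from test functions to `L²(Ω, P)`: by `SpatialCorrelation.inner_toU`, the
covariance of `W φ` and `W ψ` is the inner product in `U_T` of the curves `t ↦ φ(t, ·)` and
`t ↦ ψ(t, ·)`, which are continuous in `U` (`SpaceTimeTest.continuous_toU_slice`). An inner-product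
preserving map is automatically linear, and the curves of test functions supported in `[0,T] × ℝᵈ`
are dense in `U_T` (`SpatialCorrelation.denseRange_toUT`): a curve `g` orthogonal to all products
`a(t) ψ(x)` satisfies `∫ a(t) g(t) dt = 0` for all smooth `a` compactly supported in `(0,T)`, and
so it vanishes. This gives the unique isometric extension `I_T`. The extensions for different `T`
agree on `1_{[0,t]} h`, because the test functions approximating it over the shorter interval
approximate it equally well over the longer one.

Convergence in `L²` preserves characteristic functions, so every `I_T h` is centred Gaussian with
variance `‖h‖²`. Linear combinations of values of `I_T` are again values of `I_T`, so the values form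
a Gaussian process, although each `W φ` is only assumed Gaussian individually. For `h` in `U`, the
process `t ↦ I_T (1_{[0,t]} h)` has covariance `min(s, t) ‖h‖²`; uncorrelated jointly Gaussian
increments are independent.

Continuous versions come from the Kolmogorov–Chentsov theorem
(`ProbabilityTheory.IsKolmogorovProcess.exists_continuous_modification`), applied with the
Gaussian fourth moment `E |X_t - X_s|⁴ = M |t - s|²`. The dyadic increments then decay geometrically
almost surely, and the dyadic step approximations of the paths converge locally uniformly to a
continuous limit.
-/

/-! ### The Hilbert space `U` -/

namespace SpatialCorrelation

variable {d : ℕ} [NeZero d] (C : SpatialCorrelation d)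

theorem toU_add (φ ψ : 𝓢(Space d, ℝ)) : C.toU (φ + ψ) = C.toU φ + C.toU ψ :=
  UniformSpace.Completion.coe_add (α := C.PreU) φ ψ

theorem toU_smul (r : ℝ) (φ : 𝓢(Space d, ℝ)) : C.toU (r • φ) = r • C.toU φ :=
  UniformSpace.Completion.coe_smul (X := C.PreU) r φ

theorem toU_sub (φ ψ : 𝓢(Space d, ℝ)) : C.toU (φ - ψ) = C.toU φ - C.toU ψ :=
  UniformSpace.Completion.coe_sub (α := C.PreU) φ ψ

theorem denseRange_toU : DenseRange C.toU :=
  UniformSpace.Completion.denseRange_coe (α := C.PreU)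

/-- The inner product of `U` as one absolutely convergent integral, in the variables `x - y` and
`x`. -/
theorem inner_toU_eq_integral_prod (φ ψ : 𝓢(Space d, ℝ)) :
    inner ℝ (C.toU φ) (C.toU ψ) =
      ∫ p : Space d × Space d, C.f p.1 * (φ p.2 * ψ (p.2 - p.1)) ∂(volume.prod volume) := by
  rw [inner_toU, integral_prod_symm _ (C.integrable_prod φ ψ)]
  congr with x
  rw [← integral_sub_left_eq_self _ volume x]
  congr with z
  simp; ring

/-- Convergence in a sufficiently strong weighted sup norm implies convergence in `U`. -/
theorem exists_norm_toU_le : ∃ (k : ℕ) (K : ℝ), 0 ≤ K ∧ ∀ (φ : 𝓢(Space d, ℝ)) (A : ℝ), 0 ≤ A →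
    (∀ x, |φ x| ≤ A * ((1 + ‖x‖) ^ k)⁻¹) → ‖C.toU φ‖ ≤ A * K := by
  obtain ⟨N, hN⟩ := C.exists_integrable_weight
  have hd : Integrable (fun x : Space d => ((1 + ‖x‖) ^ (d + 1))⁻¹) := by
    have := integrable_one_add_norm (E := Space d) (μ := volume) (r := (d + 1 : ℕ)) (by simp)
    refine this.congr (.of_forall fun x => ?_)
    simp only []
    rw [Real.rpow_neg (by positivity), Real.rpow_natCast]
  have hint := hN.mul_prod hd
  set S : ℝ := ∫ p : Space d × Space d,
    C.f p.1 * ((1 + ‖p.1‖) ^ N)⁻¹ * ((1 + ‖p.2‖) ^ (d + 1))⁻¹ ∂(volume.prod volume)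
  refine ⟨N + (d + 1), √S, Real.sqrt_nonneg _, fun φ A hA h => ?_⟩
  have h0 : ∀ᵐ p : Space d × Space d ∂(volume.prod volume), 0 ≤ C.f p.1 :=
    Measure.quasiMeasurePreserving_fst.ae C.ae_nonneg
  have hbound : ∀ᵐ p : Space d × Space d ∂(volume.prod volume),
      ‖C.f p.1 * (φ p.2 * φ (p.2 - p.1))‖ ≤
        A ^ 2 * (C.f p.1 * ((1 + ‖p.1‖) ^ N)⁻¹ * ((1 + ‖p.2‖) ^ (d + 1))⁻¹) := by
    filter_upwards [h0] with p hp
    obtain ⟨z, x⟩ := p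
    simp only at hp ⊢
    rw [norm_mul, norm_mul, Real.norm_of_nonneg hp]
    have h1 : (1 + ‖z‖) ≤ (1 + ‖x‖) * (1 + ‖x - z‖) := by
      have : ‖z‖ ≤ ‖x‖ + ‖x - z‖ := by
        calc ‖z‖ = ‖x - (x - z)‖ := by simp
          _ ≤ _ := norm_sub_le _ _
      nlinarith [mul_nonneg (norm_nonneg x) (norm_nonneg (x - z))]
    -- Peetre's inequality moves the decay of the two Schwartz functions onto `f`.
    have h2 : ((1 + ‖x‖) ^ N)⁻¹ * ((1 + ‖x - z‖) ^ N)⁻¹ ≤ ((1 + ‖z‖) ^ N)⁻¹ := by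
      rw [← mul_inv, ← mul_pow]
      gcongr
    have h3 : ‖φ (x - z)‖ ≤ A * ((1 + ‖x - z‖) ^ N)⁻¹ := by
      refine (h _).trans ?_
      gcongr
      · linarith [norm_nonneg (x - z)]
      · omega
    calc C.f z * (‖φ x‖ * ‖φ (x - z)‖)
        ≤ C.f z * ((A * ((1 + ‖x‖) ^ (N + (d + 1)))⁻¹) * (A * ((1 + ‖x - z‖) ^ N)⁻¹)) := by
          gcongr
          exact h x
      _ = A ^ 2 * (C.f z * (((1 + ‖x‖) ^ N)⁻¹ * ((1 + ‖x - z‖) ^ N)⁻¹) *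
            ((1 + ‖x‖) ^ (d + 1))⁻¹) := by
          rw [pow_add, mul_inv]; ring
      _ ≤ _ := by gcongr
  have hsq : ‖C.toU φ‖ ^ 2 ≤ A ^ 2 * S := by
    rw [← real_inner_self_eq_norm_sq, inner_toU_eq_integral_prod, ← integral_const_mul]
    exact (Real.le_norm_self _).trans
      (norm_integral_le_of_norm_le (hint.const_mul _) hbound)
  calc ‖C.toU φ‖ = √(‖C.toU φ‖ ^ 2) := (Real.sqrt_sq (norm_nonneg _)).symm
    _ ≤ √(A ^ 2 * S) := Real.sqrt_le_sqrt hsq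
    _ = A * √S := by rw [Real.sqrt_mul (sq_nonneg A), Real.sqrt_sq hA]

open scoped ContDiff in
/-- Cutting off a Schwartz function far from the origin changes it little in `U`, so compactly
supported Schwartz functions are dense in `U`. -/
theorem dense_toU_hasCompactSupport :
    Dense {u : C.U | ∃ ψ : 𝓢(Space d, ℝ), HasCompactSupport ψ ∧ C.toU ψ = u} := by
  intro u
  refine C.denseRange_toU.induction_on u isClosed_closure fun φ => ?_
  obtain ⟨k, K, hK0, hK⟩ := C.exists_norm_toU_le
  obtain ⟨A, hA0, hA⟩ := exists_decay φ (k + 1)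
  let b : ℕ → ContDiffBump (0 : Space d) := fun n => ⟨n + 1, n + 2, by positivity, by linarith⟩
  have hc : ∀ n, HasCompactSupport (fun x => b n x * φ x) := fun n =>
    (b n).hasCompactSupport.mul_right
  have hs : ∀ n, ContDiff ℝ ∞ (fun x => b n x * φ x) := fun n =>
    (b n).contDiff.mul (φ.smooth _)
  let ψ : ℕ → 𝓢(Space d, ℝ) := fun n => (hc n).toSchwartzMap (hs n)
  have hψ : ∀ n x, ψ n x = b n x * φ x := fun n x => rfl
  have hle : ∀ n : ℕ, ‖C.toU (ψ n) - C.toU φ‖ ≤ A * ((n : ℝ) + 1)⁻¹ * K := fun n => by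
    rw [← toU_sub]
    refine hK _ _ (by positivity) fun x => ?_
    rw [sub_apply, hψ]
    by_cases hx : ‖x‖ ≤ n + 1
    · rw [(b n).one_of_mem_closedBall (by simpa [b] using hx)]
      simp only [one_mul, sub_self, abs_zero]
      positivity
    · have h1 : |b n x * φ x - φ x| ≤ |φ x| := by
        have h3 : b n x * φ x - φ x = -((1 - b n x) * φ x) := by ring
        rw [h3, abs_neg, abs_mul]
        refine mul_le_of_le_one_left (abs_nonneg _) ?_
        rw [abs_le]
        constructor <;> linarith [(b n).nonneg (x := x), (b n).le_one (x := x)]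
      refine (h1.trans (hA x)).trans ?_
      have h2 : (n : ℝ) + 1 ≤ 1 + ‖x‖ := by linarith
      rw [pow_succ, mul_inv, mul_assoc, mul_comm ((n : ℝ) + 1)⁻¹]
      gcongr
  refine mem_closure_of_tendsto (f := fun n => C.toU (ψ n)) (b := atTop) ?_
    (.of_forall fun n => ⟨ψ n, hc n, rfl⟩)
  rw [tendsto_iff_norm_sub_tendsto_zero]
  refine squeeze_zero (fun _ => norm_nonneg _) hle ?_
  have := (tendsto_one_div_add_atTop_nhds_zero_nat (𝕜 := ℝ)).const_mul (A * K)
  simp only [mul_zero] at this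
  refine this.congr fun n => ?_
  rw [one_div]; ring

end SpatialCorrelation

/-! ### Test functions as curves in `U` -/

namespace SpaceTimeTest

variable {d : ℕ}

theorem slice_apply (φ : SpaceTimeTest d) (t : ℝ) (x : Space d) : φ.slice t x = φ (t, x) := rfl

theorem slice_add (φ ψ : SpaceTimeTest d) (t : ℝ) : (φ + ψ).slice t = φ.slice t + ψ.slice t := by
  ext x; simp [slice_apply]

theorem slice_smul (r : ℝ) (φ : SpaceTimeTest d) (t : ℝ) : (r • φ).slice t = r • φ.slice t := by
  ext x; simp [slice_apply]

variable [NeZero d] (C : SpatialCorrelation d)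

theorem toU_slice_eq_zero {φ : SpaceTimeTest d} {s : Set ℝ} (h : tsupport φ ⊆ s ×ˢ Set.univ)
    {t : ℝ} (ht : t ∉ s) : C.toU (φ.slice t) = 0 := by
  have : φ.slice t = (0 : ℝ) • φ.slice t := by
    ext x
    rw [smul_apply, zero_smul, slice_apply]
    exact image_eq_zero_of_notMem_tsupport fun hx => ht (h hx).1
  rw [this, C.toU_smul, zero_smul]

/-- Uniform continuity of a test function gives uniform smallness of `φ(t, ·) - φ(s, ·)` on a fixed
ball, hence smallness in `U`. -/
theorem continuous_toU_slice (φ : SpaceTimeTest d) : Continuous fun t => C.toU (φ.slice t) := by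
  obtain ⟨k, K, hK0, hK⟩ := C.exists_norm_toU_le
  obtain ⟨R, hR⟩ := φ.hasCompactSupport.isCompact.isBounded.exists_norm_le
  have huc := φ.hasCompactSupport.uniformContinuous_of_continuous φ.continuous
  rw [Metric.uniformContinuous_iff] at huc
  refine Metric.continuous_iff.2 fun s ε hε => ?_
  set A : ℝ := (1 + |R|) ^ k * (K + 1) with hA
  have hA0 : 0 < A := by positivity
  obtain ⟨δ, hδ, h⟩ := huc (ε / A) (by positivity)
  refine ⟨δ, hδ, fun t ht => ?_⟩
  rw [dist_eq_norm, ← C.toU_sub]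
  refine (hK (φ.slice t - φ.slice s) (ε / A * (1 + |R|) ^ k) (by positivity) fun x => ?_).trans_lt ?_
  · rw [sub_apply, slice_apply, slice_apply]
    by_cases hx : ‖x‖ ≤ |R|
    · have h1 : |φ (t, x) - φ (s, x)| ≤ ε / A := by
        refine (h ?_).le
        rw [Prod.dist_eq, dist_self]
        exact max_lt ht hδ
      refine h1.trans ?_
      rw [mul_assoc, ← div_eq_mul_inv]
      refine le_mul_of_one_le_right (by positivity) ?_
      rw [one_le_div (by positivity)]
      gcongr
    · have hz : ∀ r, φ (r, x) = 0 := fun r => by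
        refine image_eq_zero_of_notMem_tsupport fun hm => hx ?_
        exact ((norm_snd_le (r, x)).trans (hR _ hm)).trans (le_abs_self R)
      rw [hz, hz, sub_self, abs_zero]
      positivity
  · calc ε / A * (1 + |R|) ^ k * K = ε * ((1 + |R|) ^ k * K / A) := by ring
      _ < ε * 1 := by
        gcongr
        rw [div_lt_one hA0, hA]
        gcongr
        linarith
      _ = ε := mul_one _

end SpaceTimeTest

namespace SpaceTimeTest

variable {d : ℕ}

/-- The space of test functions whose support lies in `[0,T] × ℝᵈ`. -/
noncomputable def supportedIn (d : ℕ) (T : ℝ) : Submodule ℝ (SpaceTimeTest d) where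
  carrier := {φ | tsupport φ ⊆ Set.Icc 0 T ×ˢ Set.univ}
  add_mem' {φ ψ} hφ hψ := (tsupport_add φ ψ).trans (Set.union_subset hφ hψ)
  zero_mem' := by
    have : ⇑(0 : SpaceTimeTest d) = 0 := rfl
    simp [this]
  smul_mem' c φ hφ := (tsupport_smul_subset_right (fun _ => c) φ).trans hφ

theorem supportedIn_mono {T T' : ℝ} (h : T ≤ T') : supportedIn d T ≤ supportedIn d T' :=
  fun _ hφ => hφ.trans (Set.prod_mono_left (Set.Icc_subset_Icc_right h))

open scoped ContDiff in
/-- The test function `(t, x) ↦ a(t) ψ(x)`. -/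
noncomputable def tensor (a : ℝ → ℝ) (ha : ContDiff ℝ ∞ a) (ha' : HasCompactSupport a)
    (ψ : 𝓢(Space d, ℝ)) (hψ : HasCompactSupport ψ) : SpaceTimeTest d where
  toFun p := a p.1 * ψ p.2
  contDiff' := (ha.comp contDiff_fst).mul ((ψ.smooth _).comp contDiff_snd)
  hasCompactSupport' := by
    refine HasCompactSupport.intro (ha'.isCompact.prod hψ.isCompact) fun p hp => ?_
    by_contra h
    exact hp ⟨subset_closure (left_ne_zero_of_mul h), subset_closure (right_ne_zero_of_mul h)⟩
  tsupport_subset' := fun _ _ => trivial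

variable [NeZero d] (C : SpatialCorrelation d)

theorem memLp_toU_slice (φ : SpaceTimeTest d) (T : ℝ) :
    MemLp (fun t => C.toU (φ.slice t)) 2 (volume.restrict (Set.Icc (0 : ℝ) T)) := by
  have hc := φ.continuous_toU_slice C
  obtain ⟨B, hB⟩ := isCompact_Icc.exists_bound_of_continuousOn (hc.continuousOn (s := Set.Icc 0 T))
  refine MemLp.of_bound hc.aestronglyMeasurable B ?_
  filter_upwards [ae_restrict_mem measurableSet_Icc] with t ht using hB t ht

end SpaceTimeTest

/-! ### Density of test functions in `U_T` -/

namespace SpatialCorrelation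

variable {d : ℕ} [NeZero d] (C : SpatialCorrelation d)

/-- A test function `φ` viewed as the element `t ↦ φ(t, ·)` of `U_T`. The support of `φ` is
arbitrary: only the restriction of `φ` to `[0,T] × ℝᵈ` matters. -/
noncomputable def toUT (T : ℝ) : SpaceTimeTest d →ₗ[ℝ] C.UT T where
  toFun φ := (φ.memLp_toU_slice C T).toLp
  map_add' φ ψ := by
    rw [← MemLp.toLp_add]
    exact MemLp.toLp_congr _ _ (.of_forall fun t => by simp [SpaceTimeTest.slice_add, toU_add])
  map_smul' r φ := by
    rw [RingHom.id_apply, ← MemLp.toLp_const_smul]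
    exact MemLp.toLp_congr _ _ (.of_forall fun t => by simp [SpaceTimeTest.slice_smul, toU_smul])

theorem coeFn_toUT (T : ℝ) (φ : SpaceTimeTest d) :
    C.toUT T φ =ᵐ[volume.restrict (Set.Icc (0 : ℝ) T)] fun t => C.toU (φ.slice t) :=
  (φ.memLp_toU_slice C T).coeFn_toLp

/-- The inner product in `U_T` is the covariance of the noise; the support condition discards the
times after `T`. -/
theorem inner_toUT {T : ℝ} {φ : SpaceTimeTest d} (hφ : φ ∈ SpaceTimeTest.supportedIn d T)
    (ψ : SpaceTimeTest d) : inner ℝ (C.toUT T φ) (C.toUT T ψ) =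
      ∫ t in Set.Ici (0 : ℝ), ∫ x, ∫ y, φ (t, x) * C.f (x - y) * ψ (t, y) := by
  have h1 : inner ℝ (C.toUT T φ) (C.toUT T ψ) =
      ∫ t in Set.Icc 0 T, inner ℝ (C.toU (φ.slice t)) (C.toU (ψ.slice t)) := by
    rw [L2.inner_def]
    refine integral_congr_ae ?_
    filter_upwards [C.coeFn_toUT T φ, C.coeFn_toUT T ψ] with t h1 h2
    rw [h1, h2]
  have h2 : ∀ t, inner ℝ (C.toU (φ.slice t)) (C.toU (ψ.slice t)) =
      ∫ x, ∫ y, φ (t, x) * C.f (x - y) * ψ (t, y) := fun t => C.inner_toU _ _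
  rw [h1]
  simp_rw [← h2]
  refine (setIntegral_eq_of_subset_of_forall_sdiff_eq_zero measurableSet_Ici
    Set.Icc_subset_Ici_self fun t ht => ?_).symm
  rw [SpaceTimeTest.toU_slice_eq_zero C hφ ht.2, inner_zero_left]

/-- An element of `U_T` orthogonal to all `a(t) ψ(x)` satisfies `∫ a(t) g(t) dt = 0` for every smooth
`a` compactly supported in `(0,T)`, because the `ψ` are dense in `U`; hence it vanishes. -/
theorem denseRange_toUT (T : ℝ) :
    DenseRange ((C.toUT T).domRestrict (SpaceTimeTest.supportedIn d T)) := by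
  rw [DenseRange, ← LinearMap.coe_range, Submodule.dense_iff_topologicalClosure_eq_top,
    Submodule.topologicalClosure_eq_top_iff, Submodule.eq_bot_iff]
  intro g hg
  rw [Submodule.mem_orthogonal] at hg
  have hgi : IntegrableOn g (Set.Icc 0 T) := (Lp.memLp g).integrable one_le_two
  have key : ∀ᵐ t, t ∈ Set.Ioo 0 T → g t = 0 := by
    refine isOpen_Ioo.ae_eq_zero_of_integral_contDiff_smul_eq_zero
      (hgi.mono_set Set.Ioo_subset_Icc_self).locallyIntegrableOn fun a ha hac has => ?_
    have has' : Function.support a ⊆ Set.Icc 0 T :=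
      (subset_tsupport a).trans (has.trans Set.Ioo_subset_Icc_self)
    obtain ⟨B, hB⟩ := ha.continuous.bounded_above_of_compact_support hac
    have hint : IntegrableOn (fun t => a t • g t) (Set.Icc 0 T) :=
      hgi.bdd_smul B ha.continuous.aestronglyMeasurable (.of_forall hB)
    rw [← setIntegral_eq_integral_of_forall_compl_eq_zero (s := Set.Icc 0 T) fun t ht => by
      rw [Function.notMem_support.1 fun h => ht (has' h), zero_smul]]
    refine C.dense_toU_hasCompactSupport.eq_zero_of_inner_right ℝ ?_
    rintro _ ⟨ψ, hψ, rfl⟩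
    have hmem : SpaceTimeTest.tensor a ha hac ψ hψ ∈ SpaceTimeTest.supportedIn d T := by
      refine closure_minimal (fun p hp => ?_) (isClosed_Icc.prod isClosed_univ)
      exact ⟨has' (left_ne_zero_of_mul hp), trivial⟩
    have h := hg _ (LinearMap.mem_range_self
      ((C.toUT T).domRestrict (SpaceTimeTest.supportedIn d T)) ⟨_, hmem⟩)
    rw [LinearMap.domRestrict_apply, L2.inner_def] at h
    rw [← integral_inner hint]
    refine (integral_congr_ae ?_).trans h
    filter_upwards [C.coeFn_toUT T (SpaceTimeTest.tensor a ha hac ψ hψ)] with t ht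
    have hslice : (SpaceTimeTest.tensor a ha hac ψ hψ).slice t = a t • ψ := rfl
    rw [ht, hslice, toU_smul, inner_smul_left, inner_smul_right]
    rfl
  refine (Lp.eq_zero_iff_ae_eq_zero).2 ?_
  have h := (ae_restrict_iff' measurableSet_Ioo).2 key
  rwa [Measure.restrict_congr_set Ioo_ae_eq_Icc] at h

theorem inner_indicatorUT {T s t : ℝ} (hs0 : 0 ≤ s) (hs : s ≤ T) (ht0 : 0 ≤ t) (ht : t ≤ T)
    (φ ψ : C.U) :
    inner ℝ (C.indicatorUT T s φ) (C.indicatorUT T t ψ) = min s t * inner ℝ φ ψ := by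
  rw [indicatorUT, indicatorUT, L2.inner_indicatorConstLp_indicatorConstLp, smul_eq_mul,
    Set.Icc_inter_Icc, measureReal_restrict_apply measurableSet_Icc, Set.Icc_inter_Icc]
  simp [hs, ht, hs0, ht0]

/-- The distance from a test function supported in `[0,T] × ℝᵈ` to `1_{[0,t]} h`, `t ≤ T`, does not
change when both are considered over a longer time interval. -/
theorem dist_toUT_indicatorUT {T T' t : ℝ} (hT : T ≤ T') (ht : t ≤ T) {φ : SpaceTimeTest d}
    (hφ : φ ∈ SpaceTimeTest.supportedIn d T) (h : C.U) :
    dist (C.indicatorUT T' t h) (C.toUT T' φ) = dist (C.indicatorUT T t h) (C.toUT T φ) := by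
  let F : ℝ → C.U := (Set.Icc 0 t).indicator (fun _ => h) - fun r => C.toU (φ.slice r)
  have hF : Function.support F ⊆ Set.Icc 0 T := fun r hr => by
    by_contra hn
    refine hr ?_
    have h1 : r ∉ Set.Icc 0 t := fun h => hn ⟨h.1, h.2.trans ht⟩
    simp only [F, Pi.sub_apply, Set.indicator_of_notMem h1,
      SpaceTimeTest.toU_slice_eq_zero C hφ hn, sub_zero]
  have key : ∀ S, T ≤ S → dist (C.indicatorUT S t h) (C.toUT S φ) = (eLpNorm F 2 volume).toReal :=
    fun S hS => by
    rw [Lp.dist_def, ← eLpNorm_restrict_eq_of_support_subset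
      (hF.trans (Set.Icc_subset_Icc_right hS))]
    congr 1
    refine eLpNorm_congr_ae ?_
    exact indicatorConstLp_coeFn.sub (C.coeFn_toUT S φ)
  rw [key T' hT, key T le_rfl]

end SpatialCorrelation

/-! ### Extension of isometries -/

section Extension

variable {V H K : Type*} [AddCommGroup V] [Module ℝ V]
  [NormedAddCommGroup H] [InnerProductSpace ℝ H] [NormedAddCommGroup K] [InnerProductSpace ℝ K]

/-- A map `w` whose Gram kernel is that of a linear map `J` with dense range factors uniquely through
`J` as a linear isometry. Linearity of `w` is automatic, since the Gram kernel determines the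
norms of all linear combinations. -/
theorem existsUnique_linearIsometry_of_inner_eq [CompleteSpace K] (J : V →ₗ[ℝ] H)
    (hJ : DenseRange J) (w : V → K) (h : ∀ u v, inner ℝ (w u) (w v) = inner ℝ (J u) (J v)) :
    ∃! I : H →ₗᵢ[ℝ] K, ∀ v, I (J v) = w v := by
  let wl : V →ₗ[ℝ] K :=
    { toFun := w
      map_add' := fun u v => by
        rw [← sub_eq_zero, ← inner_self_eq_zero (𝕜 := ℝ)]
        simp only [inner_sub_left, inner_sub_right, inner_add_left, inner_add_right, h, map_add]
        ring
      map_smul' := fun r v => by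
        rw [← sub_eq_zero, ← inner_self_eq_zero (𝕜 := ℝ)]
        simp only [inner_sub_left, inner_sub_right, inner_smul_left, inner_smul_right, h, map_smul,
          RingHom.id_apply, conj_trivial]
        ring }
  have hw : ∀ v, wl v = w v := fun _ => rfl
  have hn : ∀ v, ‖wl v‖ ≤ 1 * ‖J v‖ := fun v => by
    rw [one_mul, hw, ← sq_le_sq₀ (norm_nonneg _) (norm_nonneg _), ← real_inner_self_eq_norm_sq,
      ← real_inner_self_eq_norm_sq, h]
  have he : ∀ v, wl.extendOfNorm J (J v) = w v := LinearMap.extendOfNorm_eq hJ ⟨1, hn⟩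
  refine ⟨(wl.extendOfNorm J).toLinearMap.isometryOfInner fun x y => ?_, he, fun I hI => ?_⟩
  · refine hJ.induction_on₂ (p := fun x y => inner ℝ (wl.extendOfNorm J x) (wl.extendOfNorm J y) =
      inner ℝ x y) ?_ (fun u v => ?_) x y
    · exact isClosed_eq (by fun_prop) (by fun_prop)
    · rw [he, he, h]
  · ext x
    refine hJ.induction_on (p := fun x => I x = wl.extendOfNorm J x) x
      (isClosed_eq I.continuous (wl.extendOfNorm J).continuous) fun v => ?_
    rw [hI, he]

end Extension

/-! ### Gaussian isometries into `L²` -/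

section Gaussian

theorem LinearIsometry.integral_mul_eq_inner {Ω : Type*} [MeasurableSpace Ω] {P : Measure Ω}
    {H : Type*} [NormedAddCommGroup H] [InnerProductSpace ℝ H] (I : H →ₗᵢ[ℝ] Lp ℝ 2 P) (g h : H) :
    ∫ ω, I g ω * I h ω ∂P = inner ℝ g h := by
  rw [← I.inner_map_map, L2.inner_def]
  refine integral_congr_ae (.of_forall fun ω => ?_)
  simp [mul_comm]

variable {Ω : Type*} [MeasurableSpace Ω] {P : Measure Ω}

/-- The characteristic function at `1` depends continuously on the random variable, in `L²`. -/
theorem continuous_integral_cexp_Lp [IsProbabilityMeasure P] :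
    Continuous fun X : Lp ℝ 2 P => ∫ ω, Complex.exp (X ω * Complex.I) ∂P := by
  have hint : ∀ X : Lp ℝ 2 P, Integrable (fun ω => Complex.exp (X ω * Complex.I)) P := fun X => by
    refine Integrable.of_bound (C := 1) ?_ (.of_forall fun ω => ?_)
    · have := (Lp.stronglyMeasurable X).measurable
      exact Measurable.aestronglyMeasurable (by fun_prop)
    · rw [Complex.norm_exp_ofReal_mul_I]
  refine LipschitzWith.continuous (K := 1) (LipschitzWith.of_dist_le_mul fun X Y => ?_)
  have hXY : Integrable (fun ω => (X - Y) ω) P := (Lp.memLp (X - Y)).integrable one_le_two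
  have hb : ∀ᵐ ω ∂P, ‖Complex.exp (X ω * Complex.I) - Complex.exp (Y ω * Complex.I)‖ ≤
      ‖(X - Y) ω‖ := by
    filter_upwards [Lp.coeFn_sub X Y] with ω hω
    rw [hω, Pi.sub_apply]
    have h1 : Complex.exp (X ω * Complex.I) - Complex.exp (Y ω * Complex.I) =
        Complex.exp (Y ω * Complex.I) *
          (Complex.exp (Complex.I * ((X ω - Y ω : ℝ) : ℂ)) - 1) := by
      rw [mul_sub, ← Complex.exp_add, mul_one]
      congr 2
      push_cast; ring
    rw [h1, norm_mul, Complex.norm_exp_ofReal_mul_I, one_mul]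
    exact Real.norm_exp_I_mul_ofReal_sub_one_le
  rw [dist_eq_norm, ← integral_sub (hint X) (hint Y), NNReal.coe_one, one_mul, dist_eq_norm]
  calc _ ≤ ∫ ω, ‖(X - Y) ω‖ ∂P := norm_integral_le_of_norm_le hXY.norm hb
    _ = (eLpNorm (X - Y) 1 P).toReal := by
      rw [eLpNorm_one_eq_lintegral_enorm, integral_norm_eq_lintegral_enorm hXY.aestronglyMeasurable]
    _ ≤ (eLpNorm (X - Y) 2 P).toReal := by
      refine ENNReal.toReal_mono (Lp.eLpNorm_ne_top _) ?_
      exact eLpNorm_le_eLpNorm_of_exponent_le one_le_two (Lp.aestronglyMeasurable _)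
    _ = ‖X - Y‖ := (Lp.norm_def _).symm

variable {H : Type*} [NormedAddCommGroup H] [InnerProductSpace ℝ H] (I : H →ₗᵢ[ℝ] Lp ℝ 2 P)

/-- Gaussianity of an isometry on a dense subspace passes to the whole space. -/
theorem LinearIsometry.hasLaw_gaussianReal [IsProbabilityMeasure P] {V : Type*} {J : V → H}
    (hJ : DenseRange J)
    (hg : ∀ v, HasGaussianLaw (I (J v)) P) (h0 : ∀ v, ∫ ω, I (J v) ω ∂P = 0) (h : H) :
    HasLaw (I h) (gaussianReal 0 (‖h‖₊ ^ 2)) P := by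
  have key : ∀ h : H, ∫ ω, Complex.exp (I h ω * Complex.I) ∂P = Complex.exp (-‖h‖ ^ 2 / 2) := by
    intro h
    refine hJ.induction_on (p := fun h => ∫ ω, Complex.exp (I h ω * Complex.I) ∂P =
      Complex.exp (-‖h‖ ^ 2 / 2)) h ?_ fun v => ?_
    · exact isClosed_eq (continuous_integral_cexp_Lp.comp I.continuous) (by fun_prop)
    · have hm := (hg v).aemeasurable
      have h2 : Var[I (J v); P] = ‖J v‖ ^ 2 := by
        rw [variance_of_integral_eq_zero hm (h0 v), ← I.norm_map, ← real_inner_self_eq_norm_sq,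
          L2.inner_def]
        refine integral_congr_ae (.of_forall fun ω => ?_)
        simp [sq]
      have h3 := charFun_apply_real (μ := P.map (I (J v))) 1
      rw [integral_map hm (by fun_prop), (hg v).map_eq_gaussianReal, h0, h2,
        charFun_gaussianReal] at h3
      simp only [Complex.ofReal_one, one_mul] at h3
      rw [← h3]
      congr 1
      simp
      ring
  have hm : AEMeasurable (I h) P := (Lp.aestronglyMeasurable _).aemeasurable
  refine ⟨hm, ?_⟩
  have := Measure.isProbabilityMeasure_map hm
  refine Measure.ext_of_charFun (funext fun t => ?_)
  rw [charFun_apply_real, charFun_gaussianReal, integral_map hm (by fun_prop)]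
  have h1 := key (t • h)
  have h2 : ∫ ω, Complex.exp (I (t • h) ω * Complex.I) ∂P =
      ∫ ω, Complex.exp (t * I h ω * Complex.I) ∂P := by
    rw [map_smul]
    refine integral_congr_ae ?_
    filter_upwards [Lp.coeFn_smul t (I h)] with ω hω
    rw [hω]
    simp
  rw [← h2, h1, norm_smul]
  congr 1
  push_cast
  rw [mul_pow, ← Complex.ofReal_pow, Real.norm_eq_abs, sq_abs]
  push_cast
  ring

/-- An isometry into `L²` all of whose values are centred Gaussian is a Gaussian process, since
its linear combinations are again values of it. -/
theorem LinearIsometry.isGaussianProcess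
    (hI : ∀ h, HasLaw (I h) (gaussianReal 0 (‖h‖₊ ^ 2)) P) :
    IsGaussianProcess (fun (h : H) ω => I h ω) P where
  hasGaussianLaw s := by
    classical
    have hm : AEMeasurable (fun ω => s.restrict fun h => I h ω) P :=
      aemeasurable_pi_lambda _ fun h => (hI h).aemeasurable
    refine ⟨isGaussian_of_map_eq_gaussianReal fun L => ?_⟩
    let c : s → ℝ := fun i => L fun j => if i = j then 1 else 0
    refine ⟨0, ‖∑ i, c i • (i : H)‖₊ ^ 2, ?_⟩
    rw [AEMeasurable.map_map_of_aemeasurable L.continuous.aemeasurable hm, ← (hI _).map_eq]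
    refine Measure.map_congr ?_
    have h1 : ∀ᵐ ω ∂P, ∀ i : s, (c i • I (i : H)) ω = c i * I (i : H) ω :=
      ae_all_iff.2 fun i => by
        filter_upwards [Lp.coeFn_smul (c i) (I (i : H))] with ω hω
        rw [hω]; rfl
    have h2 : I (∑ i, c i • (i : H)) =ᵐ[P] ∑ i, ⇑(c i • I (i : H)) := by
      rw [map_sum]
      simp_rw [map_smul]
      exact Lp.coeFn_finsetSum _ _
    filter_upwards [h1, h2] with ω h1 h2
    rw [h2, Finset.sum_apply, Function.comp_apply, ← L.coe_coe,
      LinearMap.pi_apply_eq_sum_univ]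
    refine Finset.sum_congr rfl fun i _ => ?_
    rw [h1, smul_eq_mul, mul_comm]
    rfl

end Gaussian

/-! ### Dyadic approximation of paths -/

section Dyadic

/-- The largest dyadic number of level `n` that is at most `t`. -/
noncomputable def dyadicFloor (n : ℕ) (t : ℝ≥0) : ℝ≥0 := (⌊2 ^ n * t⌋₊ : ℝ≥0) / 2 ^ n

theorem dyadicFloor_le (n : ℕ) (t : ℝ≥0) : dyadicFloor n t ≤ t := by
  rw [dyadicFloor, div_le_iff₀ (by positivity), mul_comm t]
  exact Nat.floor_le (by positivity)

theorem le_dyadicFloor_add (n : ℕ) (t : ℝ≥0) : t ≤ dyadicFloor n t + (2 ^ n)⁻¹ := by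
  rw [dyadicFloor, ← one_div, ← add_div, le_div_iff₀ (by positivity), mul_comm t]
  exact (Nat.lt_floor_add_one _).le

theorem floor_two_mul (a : ℝ≥0) : ⌊2 * a⌋₊ = 2 * ⌊a⌋₊ ∨ ⌊2 * a⌋₊ = 2 * ⌊a⌋₊ + 1 := by
  have h1 := Nat.floor_le (zero_le (a := a))
  have h2 := Nat.lt_floor_add_one a
  have h3 : 2 * ⌊a⌋₊ ≤ ⌊2 * a⌋₊ := Nat.le_floor (by push_cast; gcongr)
  have h4 : ⌊2 * a⌋₊ < 2 * ⌊a⌋₊ + 2 := by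
    rw [Nat.floor_lt (by positivity)]
    push_cast
    calc 2 * a < 2 * ((⌊a⌋₊ : ℝ≥0) + 1) := by gcongr
      _ = _ := by ring
  omega

theorem floor_lt_two_pow_mul {N : ℕ} {t : ℝ≥0} (n : ℕ) (ht : t < N) :
    ⌊2 ^ n * t⌋₊ < N * 2 ^ n := by
  rw [Nat.floor_lt (by positivity)]
  push_cast
  rw [mul_comm]
  gcongr

variable {x : ℝ≥0 → ℝ} {C r : ℝ} {N : ℕ}

/-- Refining the level either fixes the dyadic floor or moves it by one step of the finer level. -/
theorem dist_dyadicFloor_succ_le (hC : 0 ≤ C) (hr : 0 ≤ r)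
    (h : ∀ n k : ℕ, k < N * 2 ^ n →
      dist (x ((k : ℝ≥0) / 2 ^ n)) (x (((k + 1 : ℕ) : ℝ≥0) / 2 ^ n)) ≤ C * r ^ n)
    {t : ℝ≥0} (ht : t < N) (n : ℕ) :
    dist (x (dyadicFloor n t)) (x (dyadicFloor (n + 1) t)) ≤ C * r * r ^ n := by
  have e : dyadicFloor n t = ((2 * ⌊2 ^ n * t⌋₊ : ℕ) : ℝ≥0) / 2 ^ (n + 1) := by
    rw [dyadicFloor, pow_succ', Nat.cast_mul, Nat.cast_ofNat, mul_div_mul_left _ _ two_ne_zero]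
  have e' : dyadicFloor (n + 1) t = (⌊2 * (2 ^ n * t)⌋₊ : ℝ≥0) / 2 ^ (n + 1) := by
    rw [dyadicFloor, pow_succ', mul_assoc]
  have hk := floor_lt_two_pow_mul (n + 1) ht
  rw [pow_succ' (2 : ℝ≥0), mul_assoc] at hk
  rw [e, e', mul_assoc C, ← pow_succ']
  rcases floor_two_mul (2 ^ n * t) with h1 | h1
  · rw [h1, dist_self]
    positivity
  · rw [h1] at hk ⊢
    exact h _ _ (by omega)

/-- Dyadic floors of points at distance at most one step of level `n` are equal or consecutive. -/
theorem dist_dyadicFloor_le (hC : 0 ≤ C) (hr : 0 ≤ r)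
    (h : ∀ n k : ℕ, k < N * 2 ^ n →
      dist (x ((k : ℝ≥0) / 2 ^ n)) (x (((k + 1 : ℕ) : ℝ≥0) / 2 ^ n)) ≤ C * r ^ n)
    {s t : ℝ≥0} (hst : s ≤ t) (ht : t < N) {n : ℕ} (hn : t ≤ s + (2 ^ n)⁻¹) :
    dist (x (dyadicFloor n s)) (x (dyadicFloor n t)) ≤ C * r ^ n := by
  have h1 : ⌊2 ^ n * s⌋₊ ≤ ⌊2 ^ n * t⌋₊ := Nat.floor_mono (by gcongr)
  have h2 : ⌊2 ^ n * t⌋₊ ≤ ⌊2 ^ n * s⌋₊ + 1 := by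
    rw [← Nat.floor_add_one (by positivity)]
    refine Nat.floor_mono ?_
    calc 2 ^ n * t ≤ 2 ^ n * (s + (2 ^ n)⁻¹) := by gcongr
      _ = 2 ^ n * s + 1 := by rw [mul_add, mul_inv_cancel₀ (by positivity)]
  have hk := floor_lt_two_pow_mul n ht
  unfold dyadicFloor
  rcases (show ⌊2 ^ n * t⌋₊ = ⌊2 ^ n * s⌋₊ ∨ ⌊2 ^ n * t⌋₊ = ⌊2 ^ n * s⌋₊ + 1 by omega) with h3 | h3
  · rw [h3, dist_self]
    positivity
  · rw [h3]
    exact h n _ (by omega)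

/-- Geometric decay of the dyadic increments of `x` makes the step functions
`t ↦ x (dyadicFloor n t)` converge locally uniformly. Their jumps decay geometrically too, so the
limit is continuous. -/
theorem exists_continuous_tendsto_dyadicFloor
    (h : ∀ N : ℕ, ∃ C r : ℝ, 0 ≤ C ∧ 0 ≤ r ∧ r < 1 ∧ ∀ n k : ℕ, k < N * 2 ^ n →
      dist (x ((k : ℝ≥0) / 2 ^ n)) (x (((k + 1 : ℕ) : ℝ≥0) / 2 ^ n)) ≤ C * r ^ n) :
    ∃ y : ℝ≥0 → ℝ, Continuous y ∧
      ∀ t, Tendsto (fun n => x (dyadicFloor n t)) atTop (𝓝 (y t)) := by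
  have hcauchy : ∀ t, ∃ l, Tendsto (fun n => x (dyadicFloor n t)) atTop (𝓝 l) := fun t => by
    obtain ⟨N, hN⟩ := exists_nat_gt t
    obtain ⟨C, r, hC, hr, hr1, hx⟩ := h N
    exact cauchySeq_tendsto_of_complete
      (cauchySeq_of_le_geometric r (C * r) hr1 (dist_dyadicFloor_succ_le hC hr hx hN))
  choose y hy using hcauchy
  refine ⟨y, Metric.continuous_iff.2 fun t ε hε => ?_, hy⟩
  obtain ⟨N, hN⟩ := exists_nat_gt (t + 1)
  obtain ⟨C, r, hC, hr, hr1, hx⟩ := h N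
  have hunif : ∀ s : ℝ≥0, s < N → ∀ n, dist (x (dyadicFloor n s)) (y s) ≤ C * r * r ^ n / (1 - r) :=
    fun s hs => dist_le_of_le_geometric_of_tendsto r (C * r) hr1
      (dist_dyadicFloor_succ_le hC hr hx hs) (hy s)
  have hlim : Tendsto (fun n : ℕ => C * r * r ^ n / (1 - r) + C * r ^ n + C * r * r ^ n / (1 - r))
      atTop (𝓝 0) := by
    have h0 := tendsto_pow_atTop_nhds_zero_of_lt_one hr hr1
    have := (((h0.const_mul (C * r)).div_const (1 - r)).add (h0.const_mul C)).add
      ((h0.const_mul (C * r)).div_const (1 - r))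
    simpa using this
  obtain ⟨n, hn⟩ := (hlim.eventually_lt_const hε).exists
  have hle : ∀ a b : ℝ≥0, a ≤ b → b < N → b ≤ a + (2 ^ n)⁻¹ → dist (y a) (y b) < ε :=
    fun a b hab hb hab' => by
    refine lt_of_le_of_lt ?_ hn
    refine (dist_triangle4 _ (x (dyadicFloor n a)) (x (dyadicFloor n b)) _).trans ?_
    gcongr
    · rw [dist_comm]
      exact hunif a (hab.trans_lt hb) n
    · exact dist_dyadicFloor_le hC hr hx hab hb hab'
    · exact hunif b hb n
  refine ⟨(2 ^ n)⁻¹, by positivity, fun s hs => ?_⟩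
  rw [NNReal.dist_eq, abs_lt] at hs
  have h1 : s ≤ t + (2 ^ n)⁻¹ := by
    rw [← NNReal.coe_le_coe]; push_cast; linarith [hs.2]
  have h2 : t ≤ s + (2 ^ n)⁻¹ := by
    rw [← NNReal.coe_le_coe]; push_cast; linarith [hs.1]
  have h3 : ((2 : ℝ≥0) ^ n)⁻¹ ≤ 1 := inv_le_one_of_one_le₀ (one_le_pow₀ one_le_two)
  rcases le_total s t with hst | hst
  · exact hle s t hst ((le_add_of_nonneg_right zero_le_one).trans_lt hN) h2
  · rw [dist_comm]
    exact hle t s hst ((h1.trans (by gcongr)).trans_lt hN) h1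

end Dyadic

/-! ### The Kolmogorov–Chentsov theorem -/

section Kolmogorov

variable {Ω : Type*} [MeasurableSpace Ω] {P : Measure Ω} {X : ℝ≥0 → Ω → ℝ} {p q : ℝ} {M : ℝ≥0}

theorem ENNReal.dist_le_of_edist_rpow_le {E : Type*} [PseudoMetricSpace E] (hp : 0 < p)
    {S θ : ℝ≥0∞} (hS : S ≠ ⊤) (hθ : θ ≠ ⊤) {a b : E} {n : ℕ} (h : edist a b ^ p ≤ S * θ ^ n) :
    dist a b ≤ (S ^ (1 / p)).toReal * (θ ^ (1 / p)).toReal ^ n := by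
  have hp' : 0 ≤ 1 / p := by positivity
  rw [dist_edist, ← ENNReal.toReal_pow, ← ENNReal.toReal_mul]
  refine ENNReal.toReal_mono (ENNReal.mul_ne_top (ENNReal.rpow_ne_top_of_nonneg hp' hS)
    (ENNReal.pow_ne_top (ENNReal.rpow_ne_top_of_nonneg hp' hθ))) ?_
  have h1 := ENNReal.rpow_le_rpow h hp'
  rw [← ENNReal.rpow_mul, mul_one_div_cancel hp.ne', ENNReal.rpow_one,
    ENNReal.mul_rpow_of_nonneg _ _ hp'] at h1
  refine h1.trans_eq ?_
  rw [← ENNReal.rpow_natCast, ← ENNReal.rpow_natCast, ← ENNReal.rpow_mul, ← ENNReal.rpow_mul,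
    mul_comm (n : ℝ)]

/-- Almost surely, the dyadic increments of a Kolmogorov process on `[0,N]` decay geometrically:
the `p`-th powers of the increments of all levels, weighted by `θ ^ (-n)` with
`θ = 2 ^ (-(q - 1) / 2)`, have a finite expected sum. -/
theorem ae_exists_dyadic_increment_le (hX : IsKolmogorovProcess X P p q M) (hq : 1 < q) (N : ℕ) :
    ∀ᵐ ω ∂P, ∃ C r : ℝ, 0 ≤ C ∧ 0 ≤ r ∧ r < 1 ∧ ∀ n k : ℕ, k < N * 2 ^ n →
      dist (X ((k : ℝ≥0) / 2 ^ n) ω) (X (((k + 1 : ℕ) : ℝ≥0) / 2 ^ n) ω) ≤ C * r ^ n := by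
  -- `θ ^ 2 = 2 ^ (1 - q)` is the decay rate of the expected sum of the powers over one level, so
  -- the weighted sums still decay like `θ ^ n`.
  set θ : ℝ≥0∞ := 2 ^ ((1 - q) / 2) with hθ
  have hθ0 : θ ≠ 0 := (ENNReal.rpow_pos (by simp) (by simp)).ne'
  have hθ1 : θ < 1 := ENNReal.rpow_lt_one_of_one_lt_of_neg (by simp) (by linarith)
  have hθt : θ ≠ ⊤ := hθ1.ne_top
  have hscale : ∀ n : ℕ, (2 : ℝ≥0∞) ^ n * ((2 ^ n)⁻¹) ^ q = θ ^ n * θ ^ n := fun n => by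
    rw [hθ, ← ENNReal.rpow_natCast, ← ENNReal.rpow_natCast, ← ENNReal.rpow_neg,
      ← ENNReal.rpow_mul, ← ENNReal.rpow_mul, ← ENNReal.rpow_add _ _ (by simp) (by simp),
      ← ENNReal.rpow_add _ _ (by simp) (by simp)]
    congr 1
    ring
  let e : ℕ → ℕ → Ω → ℝ≥0∞ := fun n k ω =>
    edist (X ((k : ℝ≥0) / 2 ^ n) ω) (X (((k + 1 : ℕ) : ℝ≥0) / 2 ^ n) ω) ^ p
  have hem : ∀ n k, Measurable (e n k) := fun n k => hX.measurable_edist.pow_const p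
  have hei : ∀ n k, ∫⁻ ω, e n k ω ∂P ≤ M * ((2 ^ n)⁻¹ : ℝ≥0∞) ^ q := fun n k => by
    refine (hX.kolmogorovCondition _ _).trans_eq ?_
    congr 2
    rw [edist_comm, edist_nndist, NNReal.nndist_eq, Nat.cast_add, add_div, add_tsub_cancel_left]
    simpa using le_add_left le_self_add
  let S : Ω → ℝ≥0∞ := fun ω => ∑' n, (θ ^ n)⁻¹ * ∑ k ∈ Finset.range (N * 2 ^ n), e n k ω
  have hSm : Measurable S := Measurable.tsum fun n =>
    (Finset.measurable_sum _ fun k _ => hem n k).const_mul _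
  have hS : ∫⁻ ω, S ω ∂P ≠ ⊤ := by
    refine ne_top_of_le_ne_top (b := ∑' n : ℕ, (N * M : ℝ≥0∞) * θ ^ n) ?_ ?_
    · rw [ENNReal.tsum_mul_left, ENNReal.tsum_geometric]
      refine ENNReal.mul_ne_top (by finiteness) (ENNReal.inv_ne_top.2 ?_)
      exact (tsub_pos_of_lt hθ1).ne'
    · rw [lintegral_tsum fun n =>
        ((Finset.measurable_sum _ fun k _ => hem n k).const_mul _).aemeasurable]
      refine ENNReal.tsum_le_tsum fun n => ?_
      rw [lintegral_const_mul _ (Finset.measurable_sum _ fun k _ => hem n k),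
        lintegral_finsetSum _ fun k _ => hem n k]
      calc (θ ^ n)⁻¹ * ∑ k ∈ Finset.range (N * 2 ^ n), ∫⁻ ω, e n k ω ∂P
          ≤ (θ ^ n)⁻¹ * ∑ k ∈ Finset.range (N * 2 ^ n), M * ((2 ^ n)⁻¹ : ℝ≥0∞) ^ q := by
            gcongr
            exact hei n _
        _ = (θ ^ n)⁻¹ * (N * M * (2 ^ n * ((2 ^ n)⁻¹ : ℝ≥0∞) ^ q)) := by
            rw [Finset.sum_const, Finset.card_range, nsmul_eq_mul]
            push_cast
            ring
        _ = (N * M) * θ ^ n * (θ ^ n * (θ ^ n)⁻¹) := by rw [hscale]; ring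
        _ = _ := by
            rw [ENNReal.mul_inv_cancel (pow_ne_zero _ hθ0) (ENNReal.pow_ne_top hθt), mul_one]
  filter_upwards [ae_lt_top hSm hS] with ω hω
  refine ⟨(S ω ^ (1 / p)).toReal, (θ ^ (1 / p)).toReal, ENNReal.toReal_nonneg,
    ENNReal.toReal_nonneg, ?_, fun n k hk =>
      ENNReal.dist_le_of_edist_rpow_le hX.p_pos hω.ne hθt ?_⟩
  · have := ENNReal.rpow_lt_one hθ1 (one_div_pos.2 hX.p_pos)
    exact (ENNReal.toReal_lt_toReal this.ne_top ENNReal.one_ne_top).2 this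
  · have h1 : (θ ^ n)⁻¹ * e n k ω ≤ S ω :=
      le_trans (by
        gcongr
        exact Finset.single_le_sum (f := fun k => e n k ω) (fun _ _ => zero_le)
          (Finset.mem_range.2 hk)) (ENNReal.le_tsum n)
    rw [mul_comm, ← div_eq_mul_inv,
      ENNReal.div_le_iff (pow_ne_zero _ hθ0) (ENNReal.pow_ne_top hθt)] at h1
    exact h1

/-- The expected `p`-th powers of the distances to `X t` are summable over the levels. -/
theorem ae_tendsto_dyadicFloor (hX : IsKolmogorovProcess X P p q M) (t : ℝ≥0) :
    ∀ᵐ ω ∂P, Tendsto (fun n => X (dyadicFloor n t) ω) atTop (𝓝 (X t ω)) := by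
  have hd : ∀ n, edist (dyadicFloor n t) t ≤ (2 ^ n)⁻¹ := fun n => by
    rw [edist_nndist, NNReal.nndist_eq, tsub_eq_zero_of_le (dyadicFloor_le n t),
      max_eq_right zero_le]
    have h : t - dyadicFloor n t ≤ (2 ^ n)⁻¹ :=
      tsub_le_iff_left.2 (le_dyadicFloor_add n t)
    calc ((t - dyadicFloor n t : ℝ≥0) : ℝ≥0∞) ≤ (((2 ^ n)⁻¹ : ℝ≥0) : ℝ≥0∞) := by exact_mod_cast h
      _ = _ := by simp
  have hlt : (2 : ℝ≥0∞) ^ (-q) < 1 :=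
    ENNReal.rpow_lt_one_of_one_lt_of_neg (by simp) (by linarith [hX.q_pos])
  let S : Ω → ℝ≥0∞ := fun ω => ∑' n, edist (X (dyadicFloor n t) ω) (X t ω) ^ p
  have hm : ∀ n, Measurable fun ω => edist (X (dyadicFloor n t) ω) (X t ω) ^ p := fun n =>
    hX.measurable_edist.pow_const p
  have hS : ∫⁻ ω, S ω ∂P ≠ ⊤ := by
    refine ne_top_of_le_ne_top (b := ∑' n : ℕ, (M : ℝ≥0∞) * (2 ^ (-q)) ^ n) ?_ ?_
    · rw [ENNReal.tsum_mul_left, ENNReal.tsum_geometric]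
      refine ENNReal.mul_ne_top (by finiteness) (ENNReal.inv_ne_top.2 ?_)
      exact (tsub_pos_of_lt hlt).ne'
    · rw [lintegral_tsum fun n => (hm n).aemeasurable]
      refine ENNReal.tsum_le_tsum fun n => ?_
      calc _ ≤ M * edist (dyadicFloor n t) t ^ q := hX.kolmogorovCondition _ _
        _ ≤ M * ((2 ^ n)⁻¹ : ℝ≥0∞) ^ q := by
          gcongr
          · exact hX.q_pos.le
          · exact hd n
        _ = _ := by
          rw [← ENNReal.rpow_natCast, ← ENNReal.rpow_natCast, ← ENNReal.rpow_neg,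
            ← ENNReal.rpow_mul, ← ENNReal.rpow_mul]
          congr 2
          ring
  filter_upwards [ae_lt_top (Measurable.tsum hm) hS] with ω hω
  have h0 := (ENNReal.continuous_rpow_const (y := 1 / p)).tendsto 0 |>.comp
    (ENNReal.tendsto_atTop_zero_of_tsum_ne_top hω.ne)
  rw [ENNReal.zero_rpow_of_pos (one_div_pos.2 hX.p_pos)] at h0
  rw [tendsto_iff_edist_tendsto_0]
  refine h0.congr fun n => ?_
  rw [Function.comp_apply, ← ENNReal.rpow_mul, mul_one_div_cancel hX.p_pos.ne', ENNReal.rpow_one]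

/-- The **Kolmogorov–Chentsov theorem** for real processes indexed by `ℝ≥0`: the modification is the
pointwise limit of the dyadic step approximations of the paths. -/
theorem ProbabilityTheory.IsKolmogorovProcess.exists_continuous_modification
    (hX : IsKolmogorovProcess X P p q M) (hq : 1 < q) :
    ∃ Y : ℝ≥0 → Ω → ℝ, (∀ t, Measurable (Y t)) ∧ (∀ t, Y t =ᵐ[P] X t) ∧
      ∀ᵐ ω ∂P, Continuous fun t => Y t ω := by
  refine ⟨fun t ω => limUnder atTop fun n => X (dyadicFloor n t) ω, fun t => ?_, fun t => ?_, ?_⟩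
  · exact (StronglyMeasurable.limUnder fun n => (hX.measurable _).stronglyMeasurable).measurable
  · filter_upwards [ae_tendsto_dyadicFloor hX t] with ω hω using hω.limUnder_eq
  · filter_upwards [ae_all_iff.2 fun N => ae_exists_dyadic_increment_le hX hq N] with ω hω
    obtain ⟨y, hyc, hy⟩ := exists_continuous_tendsto_dyadicFloor (x := fun t => X t ω) hω
    have : (fun t => limUnder atTop fun n => X (dyadicFloor n t) ω) = y :=
      funext fun t => (hy t).limUnder_eq
    rwa [this]

end Kolmogorov

/-! ### Brownian motion from Gaussian processes -/

section Brownian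

variable {Ω : Type*} [MeasurableSpace Ω] {P : Measure Ω} {X : ℝ≥0 → Ω → ℝ} {v : ℝ}

/-- `N(0, w)` is the image of `N(0, 1)` under multiplication by `√w`, so its fourth moment scales
like `w ^ 2`. -/
theorem lintegral_enorm_rpow_four_gaussianReal (w : ℝ≥0) :
    ∫⁻ x, ‖x‖ₑ ^ (4 : ℝ) ∂(gaussianReal 0 w) =
      w ^ (2 : ℝ) * ∫⁻ x, ‖x‖ₑ ^ (4 : ℝ) ∂(gaussianReal 0 1) := by
  have h := gaussianReal_map_const_mul (μ := 0) (v := 1) (√w)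
  have hw : (NNReal.mk (√(w : ℝ) ^ 2) (sq_nonneg _)) = w := by
    ext; simp
  rw [mul_zero, mul_one, hw] at h
  rw [← h, lintegral_map (by fun_prop) (by fun_prop), ← lintegral_const_mul _ (by fun_prop)]
  refine lintegral_congr fun x => ?_
  have h1 : ‖√(w : ℝ)‖ₑ ^ (2 : ℝ) = w := by
    rw [Real.enorm_of_nonneg (Real.sqrt_nonneg _), ENNReal.ofReal_rpow_of_nonneg (by positivity)
      (by norm_num)]
    simp
  rw [enorm_mul, ENNReal.mul_rpow_of_nonneg _ _ (by norm_num), ← h1, ← ENNReal.rpow_mul]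
  norm_num

theorem lintegral_enorm_rpow_four_gaussianReal_ne_top (w : ℝ≥0) :
    ∫⁻ x, ‖x‖ₑ ^ (4 : ℝ) ∂(gaussianReal 0 w) ≠ ⊤ := by
  have h := (memLp_id_gaussianReal (μ := 0) (v := w) 4).eLpNorm_lt_top
  have := lintegral_rpow_enorm_lt_top_of_eLpNorm_lt_top (by norm_num) (by norm_num) h
  simpa using this.ne

/-- Brownian increments satisfy `E |X t - X s| ^ 4 = M |t - s| ^ 2`, by Gaussian scaling. -/
theorem exists_isKolmogorovProcess (hm : ∀ t, Measurable (X t))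
    (hX : ∀ s t, s ≤ t →
      HasLaw (fun ω => X t ω - X s ω) (gaussianReal 0 (v.toNNReal * (t - s))) P) :
    ∃ M : ℝ≥0, IsKolmogorovProcess X P 4 2 M := by
  set m := ∫⁻ x, ‖x‖ₑ ^ (4 : ℝ) ∂(gaussianReal 0 1) with hmdef
  have hmt : m ≠ ⊤ := lintegral_enorm_rpow_four_gaussianReal_ne_top 1
  refine ⟨v.toNNReal ^ 2 * m.toNNReal, .mk_of_secondCountableTopology hm (fun s t => ?_)
    (by norm_num) (by norm_num)⟩
  wlog hst : s ≤ t generalizing s t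
  · simp_rw [edist_comm (X s _), edist_comm s]
    exact this t s (le_of_not_ge hst)
  have h1 : edist s t = (t - s : ℝ≥0) := by
    rw [edist_nndist, NNReal.nndist_eq, tsub_eq_zero_of_le hst, max_eq_right zero_le]
  have h2 : ∫⁻ ω, edist (X s ω) (X t ω) ^ (4 : ℝ) ∂P =
      ∫⁻ x, ‖x‖ₑ ^ (4 : ℝ) ∂(gaussianReal 0 (v.toNNReal * (t - s))) := by
    rw [← (hX s t hst).map_eq, lintegral_map' (by fun_prop) (hX s t hst).aemeasurable]
    simp_rw [edist_comm (X s _), edist_eq_enorm_sub]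
  rw [h2, lintegral_enorm_rpow_four_gaussianReal, h1]
  rw [← hmdef]
  push_cast
  rw [ENNReal.coe_toNNReal hmt, ENNReal.mul_rpow_of_nonneg _ _ (by norm_num)]
  simp only [ENNReal.rpow_ofNat]
  exact le_of_eq (by ring)

variable [IsProbabilityMeasure P]

theorem ProbabilityTheory.IsGaussianProcess.hasLaw_sub (hg : IsGaussianProcess X P)
    (h0 : ∀ t, ∫ ω, X t ω ∂P = 0) (hc : ∀ s t, ∫ ω, X s ω * X t ω ∂P = (min s t : ℝ≥0) * v)
    {s t : ℝ≥0} (hst : s ≤ t) :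
    HasLaw (fun ω => X t ω - X s ω) (gaussianReal 0 (v.toNNReal * (t - s))) P := by
  have hG : HasGaussianLaw (fun ω => X t ω - X s ω) P := hg.hasGaussianLaw_fun_sub
  have hL : ∀ r, MemLp (X r) 2 P := fun r => (hg.hasGaussianLaw_eval r).memLp_two
  have hmean : ∫ ω, (X t ω - X s ω) ∂P = 0 := by
    rw [integral_sub ((hL t).integrable one_le_two) ((hL s).integrable one_le_two), h0, h0, sub_zero]
  have hint : ∀ a b, Integrable (fun ω => X a ω * X b ω) P := fun a b =>
    (hL a).integrable_mul (hL b)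
  have hvar : Var[fun ω => X t ω - X s ω; P] = v * (t - s) := by
    rw [variance_of_integral_eq_zero hG.aemeasurable hmean]
    have : ∀ ω, (X t ω - X s ω) ^ 2 =
        (X t ω * X t ω - X s ω * X t ω) - (X s ω * X t ω - X s ω * X s ω) := fun ω => by ring
    simp_rw [this]
    have h1 := integral_sub ((hint t t).sub (hint s t)) ((hint s t).sub (hint s s))
    simp only [Pi.sub_apply] at h1
    rw [h1, integral_sub (hint t t) (hint s t), integral_sub (hint s t) (hint s s), hc, hc, hc,
      min_self, min_self, min_eq_left hst]
    ring
  refine ⟨hG.aemeasurable, ?_⟩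
  rw [hG.map_eq_gaussianReal, hmean, hvar, ← NNReal.coe_sub hst, mul_comm v,
    Real.toNNReal_mul (NNReal.coe_nonneg _), Real.toNNReal_coe, mul_comm]

/-- A centred Gaussian process with the covariance of a Brownian motion and almost surely continuous
paths is a Brownian motion. -/
theorem ProbabilityTheory.IsGaussianProcess.isBrownianMotion (hg : IsGaussianProcess X P)
    (hv : 0 ≤ v) (h0 : ∀ t, ∫ ω, X t ω ∂P = 0)
    (hc : ∀ s t, ∫ ω, X s ω * X t ω ∂P = (min s t : ℝ≥0) * v)
    (hm : ∀ t, Measurable (X t)) (hcont : ∀ᵐ ω ∂P, Continuous fun t => X t ω) :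
    IsBrownianMotion X v P where
  variance_nonneg := hv
  measurable := hm
  start_zero := by
    have h := hc 0 0
    rw [min_self, NNReal.coe_zero, zero_mul] at h
    have hL : MemLp (X 0) 2 P := (hg.hasGaussianLaw_eval 0).memLp_two
    rw [integral_eq_zero_iff_of_nonneg (fun _ => mul_self_nonneg _) (hL.integrable_mul hL)] at h
    filter_upwards [h] with ω hω using mul_self_eq_zero.1 hω
  indep_increments := fun n t ht => by
    have hL : ∀ r, MemLp (X r) 2 P := fun r => (hg.hasGaussianLaw_eval r).memLp_two
    have hcov : ∀ a b, cov[X a, X b; P] = (min a b : ℝ≥0) * v := fun a b => by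
      rw [covariance_eq_sub (hL a) (hL b), h0, zero_mul, sub_zero, ← hc]
      rfl
    refine hg.hasGaussianLaw_increments.iIndepFun_of_covariance_eq_zero fun i j hij => ?_
    rw [covariance_fun_sub_fun_sub (hL _) (hL _) (hL _) (hL _)]
    simp_rw [hcov]
    wlog h : i < j generalizing i j
    · simp_rw [← this j i hij.symm (by grind), min_comm]
      grind
    have h1 : i.succ ≤ j.succ := Fin.strictMono_succ h |>.le
    have h2 : i.castSucc ≤ j.succ := Fin.le_of_lt h1
    have h3 : i.castSucc ≤ j.castSucc := Fin.le_castSucc_iff.mpr h1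
    rw [min_eq_left (ht h1), min_eq_left (ht h), min_eq_left (ht h2), min_eq_left (ht h3)]
    ring
  law_increments := fun s t hst => hg.hasLaw_sub h0 hc hst
  continuous_paths := hcont

end Brownian

/-! ### The stochastic integral of the noise -/

section Noise

variable {d : ℕ} {C : SpatialCorrelation d} {Ω : Type*} [MeasurableSpace Ω]
  {P : Measure Ω} {W : SpaceTimeTest d → Ω → ℝ}

namespace IsSpatiallyHomogeneousNoise

/-- The value of the noise on a test function, as an element of `L²(Ω, P)`. -/
noncomputable def toL2 (hW : IsSpatiallyHomogeneousNoise C W P) (φ : SpaceTimeTest d) : Lp ℝ 2 P :=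
  (hW.gaussian φ).memLp_two.toLp

theorem coeFn_toL2 (hW : IsSpatiallyHomogeneousNoise C W P) (φ : SpaceTimeTest d) :
    hW.toL2 φ =ᵐ[P] W φ := MemLp.coeFn_toLp _

variable [NeZero d]

/-- The defining property of an isometric extension, as an equation in `L²(Ω, P)`. -/
theorem isIsometricExtension_iff (hW : IsSpatiallyHomogeneousNoise C W P) {T : ℝ}
    {I : C.UT T →ₗᵢ[ℝ] Lp ℝ 2 P} : IsIsometricExtension C W P T I ↔
      ∀ φ ∈ SpaceTimeTest.supportedIn d T, I (C.toUT T φ) = hW.toL2 φ := by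
  refine forall₂_congr fun φ _ => ⟨?_, fun h => ⟨C.toUT T φ, C.coeFn_toUT T φ, ?_⟩⟩
  · rintro ⟨g, hg, hI⟩
    have : g = C.toUT T φ := Lp.ext (hg.trans (C.coeFn_toUT T φ).symm)
    rw [← this]
    exact Lp.ext (hI.trans (hW.coeFn_toL2 φ).symm)
  · rw [h]
    exact hW.coeFn_toL2 φ

theorem existsUnique_isIsometricExtension (hW : IsSpatiallyHomogeneousNoise C W P) (T : ℝ) :
    ∃! I : C.UT T →ₗᵢ[ℝ] Lp ℝ 2 P, IsIsometricExtension C W P T I := by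
  have h := existsUnique_linearIsometry_of_inner_eq _ (C.denseRange_toUT T)
    (fun φ : SpaceTimeTest.supportedIn d T => hW.toL2 φ) fun φ ψ => by
      rw [LinearMap.domRestrict_apply, LinearMap.domRestrict_apply, C.inner_toUT φ.2,
        ← hW.covariance, L2.inner_def]
      refine integral_congr_ae ?_
      filter_upwards [hW.coeFn_toL2 φ, hW.coeFn_toL2 ψ] with ω h1 h2
      rw [h1, h2]
      simp [mul_comm]
  simp_rw [hW.isIsometricExtension_iff]
  simpa [LinearMap.domRestrict_apply] using h

variable {T : ℝ} {I : C.UT T →ₗᵢ[ℝ] Lp ℝ 2 P}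

theorem hasLaw_gaussianReal [IsProbabilityMeasure P] (hW : IsSpatiallyHomogeneousNoise C W P)
    (hI : IsIsometricExtension C W P T I) (h : C.UT T) :
    HasLaw (I h) (gaussianReal 0 (‖h‖₊ ^ 2)) P := by
  have h1 : ∀ φ : SpaceTimeTest.supportedIn d T, W φ =ᵐ[P] I (C.toUT T φ) := fun φ => by
    rw [hW.isIsometricExtension_iff.1 hI φ φ.2]
    exact (hW.coeFn_toL2 φ).symm
  refine I.hasLaw_gaussianReal (C.denseRange_toUT T) (fun φ => ?_) (fun φ => ?_) h
  · exact (hW.gaussian φ).congr (h1 φ)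
  · exact (integral_congr_ae (h1 φ).symm).trans (hW.mean_zero φ)

/-- Test functions approximating `1_{[0,t]} h` in `U_T` also approximate it over longer time
intervals, so the stochastic integral of `1_{[0,t]} h` does not depend on the time horizon. -/
theorem apply_indicatorUT_eq (hW : IsSpatiallyHomogeneousNoise C W P) {T' : ℝ}
    {I' : C.UT T' →ₗᵢ[ℝ] Lp ℝ 2 P} (hI : IsIsometricExtension C W P T I)
    (hI' : IsIsometricExtension C W P T' I') {t : ℝ} (ht : t ≤ T) (ht' : t ≤ T') (h : C.U) :
    I (C.indicatorUT T t h) = I' (C.indicatorUT T' t h) := by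
  wlog hT : T ≤ T' generalizing T T'
  · exact (this hI' hI ht' ht (le_of_not_ge hT)).symm
  refine eq_of_forall_dist_le fun ε hε => ?_
  obtain ⟨⟨φ, hφ⟩, hd⟩ := (C.denseRange_toUT T).exists_dist_lt (C.indicatorUT T t h) (half_pos hε)
  rw [LinearMap.domRestrict_apply] at hd
  have h1 := hW.isIsometricExtension_iff.1 hI φ hφ
  have h2 := hW.isIsometricExtension_iff.1 hI' φ (SpaceTimeTest.supportedIn_mono hT hφ)
  have h3 : dist (I (C.indicatorUT T t h)) (hW.toL2 φ) < ε / 2 := by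
    rwa [← h1, I.dist_map]
  have h4 : dist (I' (C.indicatorUT T' t h)) (hW.toL2 φ) < ε / 2 := by
    rwa [← h2, I'.dist_map, C.dist_toUT_indicatorUT hT ht hφ]
  linarith [dist_triangle_right (I (C.indicatorUT T t h)) (I' (C.indicatorUT T' t h)) (hW.toL2 φ)]

end IsSpatiallyHomogeneousNoise

end Noise

/-! ### The cylindrical Wiener process -/

theorem mainTheorem9 {d : ℕ} [NeZero d] (C : SpatialCorrelation d)
    {Ω : Type*} [MeasurableSpace Ω] (P : Measure Ω) [IsProbabilityMeasure P]
    (W : SpaceTimeTest d → Ω → ℝ) (hW : IsSpatiallyHomogeneousNoise C W P) :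
    (∀ T : ℝ, 0 < T → ∃! I : C.UT T →ₗᵢ[ℝ] Lp ℝ 2 P, IsIsometricExtension C W P T I) ∧
    ∃ B : ℝ≥0 → C.U → Ω → ℝ,
      (∀ (T : ℝ), 0 < T → ∀ I : C.UT T →ₗᵢ[ℝ] Lp ℝ 2 P, IsIsometricExtension C W P T I →
        ∀ (t : ℝ≥0), (t : ℝ) ≤ T → ∀ φ : C.U, B t φ =ᵐ[P] I (C.indicatorUT T t φ)) ∧
      IsCylindricalWiener (ContinuousLinearMap.id ℝ C.U) B P ∧
      (∀ φ : C.U, IsBrownianMotion (fun t => B t φ) (‖φ‖ ^ 2) P) ∧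
      (∀ (s t : ℝ≥0) (φ ψ : C.U),
        ∫ ω, B t φ ω * B s ψ ω ∂P = (min s t : ℝ≥0) * inner ℝ φ ψ) := by
  refine ⟨fun T _ => hW.existsUnique_isIsometricExtension T, ?_⟩
  choose I hI using fun T : ℝ => (hW.existsUnique_isIsometricExtension T).exists
  -- The horizon `t` itself is long enough to define the value at time `t`.
  let X : C.U → ℝ≥0 → Lp ℝ 2 P := fun φ t => I t (C.indicatorUT t t φ)
  have hX : ∀ {T : ℝ} {J : C.UT T →ₗᵢ[ℝ] Lp ℝ 2 P}, IsIsometricExtension C W P T J →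
      ∀ {t : ℝ≥0}, (t : ℝ) ≤ T → ∀ φ, X φ t = J (C.indicatorUT T t φ) := fun hJ t ht φ =>
    hW.apply_indicatorUT_eq (hI t) hJ le_rfl ht φ
  have hcov : ∀ φ ψ s t, ∫ ω, X φ s ω * X ψ t ω ∂P = (min s t : ℝ≥0) * inner ℝ φ ψ := by
    intro φ ψ s t
    have hs : (s : ℝ) ≤ max s t := by simp
    have ht : (t : ℝ) ≤ max s t := by simp
    rw [hX (hI _) hs, hX (hI _) ht, LinearIsometry.integral_mul_eq_inner,
      C.inner_indicatorUT s.coe_nonneg hs t.coe_nonneg ht, NNReal.coe_min]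
  have hgauss : ∀ φ, IsGaussianProcess (fun t ω => X φ t ω) P := fun φ => ⟨fun s => by
    -- Finitely many times have a common horizon `T`, so all values lie in the range of `I T`.
    let T : ℝ := (s.sup id : ℝ≥0)
    have h1 := (LinearIsometry.isGaussianProcess (I T)
      (hW.hasLaw_gaussianReal (hI T))).comp_right
      (fun t : ℝ≥0 => C.indicatorUT T t φ)
    refine (h1.hasGaussianLaw s).congr (.of_forall fun ω => funext fun t => ?_)
    have ht : ((t : ℝ≥0) : ℝ) ≤ T := NNReal.coe_le_coe.2 (Finset.le_sup (f := id) t.2)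
    simp only [Finset.restrict, Function.comp_apply]
    rw [hX (hI T) ht]⟩
  have hmean : ∀ φ t, ∫ ω, X φ t ω ∂P = 0 := fun φ t => by
    rw [(hW.hasLaw_gaussianReal (hI t) _).integral_eq, integral_id_gaussianReal]
  have hXm : ∀ φ t, Measurable (X φ t) := fun φ t => (Lp.stronglyMeasurable _).measurable
  have hself : ∀ φ s t, ∫ ω, X φ s ω * X φ t ω ∂P = (min s t : ℝ≥0) * ‖φ‖ ^ 2 := fun φ s t => by
    rw [hcov, real_inner_self_eq_norm_sq]
  have hmod : ∀ φ : C.U, ∃ Y : ℝ≥0 → Ω → ℝ, (∀ t, Measurable (Y t)) ∧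
      (∀ t, Y t =ᵐ[P] X φ t) ∧ ∀ᵐ ω ∂P, Continuous fun t => Y t ω := fun φ => by
    obtain ⟨M, hM⟩ := exists_isKolmogorovProcess (hXm φ)
      fun s t hst => (hgauss φ).hasLaw_sub (hmean φ) (hself φ) hst
    exact hM.exists_continuous_modification one_lt_two
  choose Y hYm hYX hYc using hmod
  have hYcov : ∀ φ ψ s t, ∫ ω, Y φ s ω * Y ψ t ω ∂P = (min s t : ℝ≥0) * inner ℝ φ ψ := by
    intro φ ψ s t
    rw [← hcov]
    exact integral_congr_ae ((hYX φ s).mul (hYX ψ t))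
  have hB : ∀ φ, IsBrownianMotion (Y φ) (‖φ‖ ^ 2) P := fun φ =>
    ((hgauss φ).congr fun t => (hYX φ t).symm).isBrownianMotion (sq_nonneg _)
      (fun t => (integral_congr_ae (hYX φ t)).trans (hmean φ t))
      (fun s t => by rw [hYcov, real_inner_self_eq_norm_sq]) (hYm φ) (hYc φ)
  refine ⟨fun t φ => Y φ t, fun T _ J hJ t ht φ => ?_, ⟨?_, fun φ => ?_, fun s t φ ψ => ?_⟩, hB,
    fun s t φ ψ => ?_⟩
  · rw [← hX hJ ht]
    exact hYX φ t
  · exact ContinuousLinearMap.isPositive_one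
  · simpa only [ContinuousLinearMap.id_apply, real_inner_self_eq_norm_sq] using hB φ
  · exact hYcov φ ψ s t
  · rw [hYcov, min_comm]
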